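/- **Setting.** Let $\mathcal E$ be a quantum channel (a completely positive, trace-preserving linear map) on operators on $n$ qubits, $O_1,\dots,O_M$ and $\rho_1,\dots,\rho_L$ Hermitian operators on $n$ qubits, and let each of the unitary ensembles $\mathcal U_{\rm in},\mathcal U_{\rm out}$ be either $\mathcal U_{\rm P}^{\otimes n}$ (random local Pauli: a tensor product of $n$ independent uniformly random single-qubit Clifford unitaries) or $\mathcal U_{\rm C}$ (random global Clifford: a uniformly random $n$-qubit Clifford unitary). Clifford unitaries are taken modulo global phases. One run of the procedure draws $b_{\rm in}\in\{0,1\}^n$ uniformly, $U_{\rm in}\sim\mathcal U_{\rm in}$ and $U_{\rm out}\sim\mathcal U_{\rm out}$, all independent; prepares $|b_{\rm in}\rangle$; applies $U_{\rm in}$, then $\mathcal E$, then $U_{\rm out}$; and measures in the computational basis, with outcome $b_{\rm out}$. The record is $z=(b_{\rm in},U_{\rm in},U_{\rm out},b_{\rm out})$. Put $|z\rangle=\overline{U_{\rm in}}\,|b_{\rm in}\rangle\otimes U_{\rm out}^\dagger|b_{\rm out}\rangle$, where the bar is the entrywise complex conjugate, and $$\mathcal M(A)=\mathbb E_{U_{\rm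 in},U_{\rm out}}\sum_{b_{\rm in},b_{\rm out}\in\{0,1\}^n}\mathrm{Tr}\big[|z\rangle\langle z|A\big]\,|z\rangle\langle z| .$$ The shadow of the run is $\hat\zeta=\mathcal M^{-1}(|z\rangle\langle z|)$, and the single-shot estimator of $\mathrm{Tr}[\mathcal E(\rho)O]$ is $\hat o=2^n\,\mathrm{Tr}[\hat\zeta\,(\rho^T\otimes O)]$. Given $m=NK$ runs divided into $K$ batches of size $N$, let $\tilde o_j(\rho_k,N,K)$ be the median over the $K$ batches of the batch means of the single-shot estimators for $\rho_k$ and $O_j$. For an operator $A$ on $n$ qubits let $\|A\|$ be the operator norm, $\mathrm{supp}(A)$ the number of qubits on which $A$ acts nontrivially, $$\mathcal S(A)=2\left\{[2\mathrm{Tr}(A)^2+\mathrm{Tr}(A^2)]\,\mathbb I+2\mathrm{Tr}(A)A+2A^2\right\},\qquad f_{\mathcal U}(A)=\begin{cases}4^{\mathrm{supp}(A)}\|A\|^2&\text{if }\mathcal U=\mathcal U_{\rm P}^{\otimes n},\\ \|\mathcal S(A)\|&\text{if }\mathcal U=\mathcal U_{\rm C}.\end{cases}$$ **Theorem.** Let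 $\epsilon,\delta\in(0,1]$, and let $K,N$ be natural numbers with $$K\ \ge\ 2\log(2ML/\delta),\qquad N\ \ge\ \frac{34}{\epsilon^2}\,4^n\max_{1\le \ell\le L,\ 1\le j\le M} f_{\mathcal U_{\rm in}}(\rho_\ell)\,f_{\mathcal U_{\rm out}}(O_j).$$ Then, for $m=NK$ independent runs, with probability at least $1-\delta$, $$\big|\mathrm{Tr}[\mathcal E(\rho_k)O_j]-\tilde o_j(\rho_k,N,K)\big|\le\epsilon\qquad\text{for all }1\le j\le M\text{ and }1\le k\le L .$$ -/

import Mathlib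

noncomputable section

open scoped Kronecker ComplexOrder

namespace ShadowProcess

/-- `n`-bit strings; they label the computational basis of `n` qubits. -/
abbrev Bits (n : ℕ) : Type := Fin n → Fin 2

/-- Operators on `n` qubits, in the computational basis. -/
abbrev Op (n : ℕ) : Type := Matrix (Bits n) (Bits n) ℂ

/-- Operators on two registers of `n` qubits each. -/
abbrev Op2 (n : ℕ) : Type := Matrix (Bits n × Bits n) (Bits n × Bits n) ℂ

/-! ### Pauli strings and Clifford unitaries -/

/-- The single-qubit Pauli matrices `I, X, Y, Z`. -/
def pauli : Fin 4 → Matrix (Fin 2) (Fin 2) ℂ :=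
  ![!![1, 0; 0, 1], !![0, 1; 1, 0], !![0, -Complex.I; Complex.I, 0], !![1, 0; 0, -1]]

/-- The Pauli string `σ_{p 0} ⊗ ⋯ ⊗ σ_{p (n-1)}`. -/
def pauliString {n : ℕ} (p : Fin n → Fin 4) : Op n :=
  Matrix.of fun x y => ∏ i, pauli (p i) (x i) (y i)

/-- `U` is an `n`-qubit Clifford unitary: it maps Pauli strings to Pauli strings, up to sign,
under conjugation. -/
def IsClifford {n : ℕ} (U : Op n) : Prop :=
  U ∈ Matrix.unitaryGroup (Bits n) ℂ ∧
    ∀ p : Fin n → Fin 4, ∃ (s : Bool) (q : Fin n → Fin 4),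
      U * pauliString p * U.conjTranspose = (if s then (1 : ℂ) else -1) • pauliString q

/-- Two Clifford unitaries are identified if they differ by a global phase. -/
def phaseSetoid (n : ℕ) : Setoid {U : Op n // IsClifford U} where
  r U V := ∃ c : ℂ, ‖c‖ = 1 ∧ V.1 = c • U.1
  iseqv :=
    { refl := fun U => ⟨1, by simp, by simp⟩
      symm := by
        rintro U V ⟨c, hc, h⟩
        have hc0 : c ≠ 0 := by
          rintro rfl
          simp at hc
        exact ⟨c⁻¹, by simp [hc], by rw [h, smul_smul, inv_mul_cancel₀ hc0, one_smul]⟩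
      trans := by
        rintro U V W ⟨c, hc, h⟩ ⟨d, hd, h'⟩
        exact ⟨d * c, by simp [hc, hd], by rw [h', h, smul_smul]⟩ }

/-- The `n`-qubit Clifford group modulo global phases, a finite set. -/
def CliffordClass (n : ℕ) : Type := Quotient (phaseSetoid n)

/-- A unitary representing a class of `CliffordClass n`; only the global phase is chosen here, and
nothing below depends on it. -/
def CliffordClass.rep {n : ℕ} (c : CliffordClass n) : Op n := (Quotient.out c).1

/-- Every matrix unit is a linear combination of Pauli strings. -/
theorem single_eq_sum_pauliString {n : ℕ} (x y : Bits n) :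
    ∃ a : (Fin n → Fin 4) → ℂ, Matrix.single x y (1 : ℂ) = ∑ p, a p • pauliString p := by
  have h1 : ∀ a b : Fin 2, ∃ v : Fin 4 → ℂ, ∀ i j : Fin 2,
      (∑ k, v k * pauli k i j) = if a = i ∧ b = j then 1 else 0 := by
    intro a b
    fin_cases a <;> fin_cases b
    · refine ⟨![1 / 2, 0, 0, 1 / 2], fun i j => ?_⟩
      fin_cases i <;> fin_cases j <;> simp [Fin.sum_univ_four, pauli] <;> norm_num
    · refine ⟨![0, 1 / 2, Complex.I / 2, 0], fun i j => ?_⟩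
      fin_cases i <;> fin_cases j <;> simp [Fin.sum_univ_four, pauli] <;> ring_nf <;> simp <;>
        norm_num
    · refine ⟨![0, 1 / 2, -Complex.I / 2, 0], fun i j => ?_⟩
      fin_cases i <;> fin_cases j <;> simp [Fin.sum_univ_four, pauli] <;> ring_nf <;> simp <;>
        norm_num
    · refine ⟨![1 / 2, 0, 0, -1 / 2], fun i j => ?_⟩
      fin_cases i <;> fin_cases j <;> simp [Fin.sum_univ_four, pauli] <;> norm_num
  choose v hv using h1
  refine ⟨fun p => ∏ i, v (x i) (y i) (p i), ?_⟩
  ext x' y'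
  have h2 : (∏ i, ∑ k, v (x i) (y i) k * pauli k (x' i) (y' i)) =
      ∑ p : Fin n → Fin 4, ∏ i, v (x i) (y i) (p i) * pauli (p i) (x' i) (y' i) := by
    rw [Finset.prod_univ_sum, Fintype.piFinset_univ]
  rw [Matrix.sum_apply]
  simp only [Matrix.smul_apply, pauliString, Matrix.of_apply, smul_eq_mul,
    ← Finset.prod_mul_distrib]
  rw [← h2]
  simp only [hv, Matrix.single_apply]
  rw [Finset.prod_ite_zero]
  simp [funext_iff, forall_and]

instance (n : ℕ) : Finite (CliffordClass n) := by
  have key : ∀ c : CliffordClass n, ∀ p : Fin n → Fin 4, ∃ t : Bool × (Fin n → Fin 4),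
      c.rep * pauliString p * c.rep.conjTranspose =
        (if t.1 then (1 : ℂ) else -1) • pauliString t.2 := fun c p => by
    obtain ⟨s, q, h⟩ := (Quotient.out c).2.2 p
    exact ⟨(s, q), h⟩
  choose F hF using key
  refine Finite.of_injective F fun c d hcd => ?_
  have hu : c.rep ∈ Matrix.unitaryGroup (Bits n) ℂ := (Quotient.out c).2.1
  have hv : d.rep ∈ Matrix.unitaryGroup (Bits n) ℂ := (Quotient.out d).2.1
  have hu1 := Matrix.mem_unitaryGroup_iff.1 hu
  have hu2 := Matrix.mem_unitaryGroup_iff'.1 hu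
  have hv1 := Matrix.mem_unitaryGroup_iff.1 hv
  have hv2 := Matrix.mem_unitaryGroup_iff'.1 hv
  rw [Matrix.star_eq_conjTranspose] at hu1 hu2 hv1 hv2
  set U := c.rep with hU
  set V := d.rep with hV
  have hconj : ∀ p : Fin n → Fin 4,
      Commute (pauliString p) (U.conjTranspose * V) := fun p => by
    have h : U * pauliString p * U.conjTranspose = V * pauliString p * V.conjTranspose := by
      rw [hF c p, hF d p, hcd]
    change pauliString p * (U.conjTranspose * V) = U.conjTranspose * V * pauliString p
    calc pauliString p * (U.conjTranspose * V)
        = (U.conjTranspose * U) * pauliString p * U.conjTranspose * V := by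
          rw [hu2, Matrix.one_mul, Matrix.mul_assoc]
      _ = U.conjTranspose * (U * pauliString p * U.conjTranspose) * V := by
          simp only [Matrix.mul_assoc]
      _ = U.conjTranspose * V * pauliString p * (V.conjTranspose * V) := by
          rw [h]; simp only [Matrix.mul_assoc]
      _ = U.conjTranspose * V * pauliString p := by rw [hv2, Matrix.mul_one]
  have hscal : U.conjTranspose * V ∈ Set.range (Matrix.scalar (Bits n)) := by
    rw [Matrix.mem_range_scalar_iff_commute_single]
    intro x y _
    obtain ⟨a, ha⟩ := single_eq_sum_pauliString x y
    rw [ha]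
    exact Commute.sum_left _ _ _ fun p _ => (hconj p).smul_left _
  obtain ⟨z, hz⟩ := hscal
  have hVU : V = z • U := by
    calc V = U * (U.conjTranspose * V) := by rw [← Matrix.mul_assoc, hu1, Matrix.one_mul]
      _ = z • U := by
        rw [← hz, Matrix.scalar_apply, ← Matrix.smul_one_eq_diagonal, Matrix.mul_smul,
          Matrix.mul_one]
  have hnorm : ‖z‖ = 1 := by
    have h := hv1
    rw [hVU, Matrix.conjTranspose_smul, Matrix.smul_mul, Matrix.mul_smul, smul_smul, hu1] at h
    have h0 := congrFun (congrFun h (fun _ => 0)) (fun _ => 0)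
    simp only [Matrix.smul_apply, Matrix.one_apply_eq, smul_eq_mul, mul_one] at h0
    have h3 := congrArg norm h0
    rw [norm_mul, norm_star, norm_one] at h3
    nlinarith [norm_nonneg z]
  have hrel : (phaseSetoid n).r (Quotient.out c) (Quotient.out d) := ⟨z, hnorm, hVU⟩
  rw [← Quotient.out_eq c, ← Quotient.out_eq d]
  exact Quotient.sound hrel

instance (n : ℕ) : Fintype (CliffordClass n) := Fintype.ofFinite _

/-! ### Unitary ensembles -/

/-- A finite family of `n`-qubit operators, from which a member is drawn uniformly at random. -/
structure Ensemble (n : ℕ) where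
  Index : Type
  [fintype : Fintype Index]
  U : Index → Op n

attribute [instance] Ensemble.fintype

/-- The two kinds of unitary ensembles: random local Pauli and random global Clifford. -/
inductive EnsembleKind
  | localPauli
  | globalClifford

/-- `localPauli`: a tensor product of `n` independent uniformly random single-qubit Clifford
unitaries, i.e. every qubit is rotated to a uniformly random signed Pauli axis.
`globalClifford`: a uniformly random `n`-qubit Clifford unitary. -/
def ensemble (n : ℕ) : EnsembleKind → Ensemble n
  | .localPauli =>
    { Index := Fin n → CliffordClass 1
      U := fun c => Matrix.of fun x y => ∏ i, (c i).rep (fun _ => x i) (fun _ => y i) }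
  | .globalClifford =>
    { Index := CliffordClass n
      U := CliffordClass.rep }

/-! ### Quantum channels -/

/-- The map `id ⊗ E`, with an ancilla of dimension `k`. -/
def ampliation {n : ℕ} (k : ℕ) (E : Op n →ₗ[ℂ] Op n)
    (A : Matrix (Fin k × Bits n) (Fin k × Bits n) ℂ) :
    Matrix (Fin k × Bits n) (Fin k × Bits n) ℂ :=
  Matrix.of fun r s => E (Matrix.of fun x y => A (r.1, x) (s.1, y)) r.2 s.2

/-- Quantum channels: completely positive and trace-preserving maps. -/
structure IsChannel {n : ℕ} (E : Op n →ₗ[ℂ] Op n) : Prop where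
  completelyPositive : ∀ (k : ℕ) (A : Matrix (Fin k × Bits n) (Fin k × Bits n) ℂ),
    A.PosSemidef → (ampliation k E A).PosSemidef
  tracePreserving : ∀ A : Op n, (E A).trace = A.trace

/-! ### The data-collection procedure and the classical shadows -/

/-- The record of one run: input string, input unitary, output unitary, outcome. -/
structure Record {n : ℕ} (Uin Uout : Ensemble n) where
  bIn : Bits n
  uIn : Uin.Index
  uOut : Uout.Index
  bOut : Bits n

instance {n : ℕ} (Uin Uout : Ensemble n) : MeasurableSpace (Record Uin Uout) := ⊤

/-- The probability of a record `z` in one run on the channel `E`: `b_in`, `U_in`, `U_out` are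
independent and uniform, and `b_out` is obtained by measuring
`U_out E(U_in |b_in⟩⟨b_in| U_in†) U_out†` in the computational basis. -/
def recordProb {n : ℕ} {Uin Uout : Ensemble n} (E : Op n →ₗ[ℂ] Op n) (z : Record Uin Uout) : ℝ :=
  (2 ^ n : ℝ)⁻¹ * (Fintype.card Uin.Index : ℝ)⁻¹ * (Fintype.card Uout.Index : ℝ)⁻¹ *
    ((Uout.U z.uOut *
      E (Uin.U z.uIn * Matrix.single z.bIn z.bIn 1 * (Uin.U z.uIn).conjTranspose) *
      (Uout.U z.uOut).conjTranspose) z.bOut z.bOut).re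

/-- The vector `|z⟩ = conj(U_in)|b_in⟩ ⊗ U_out†|b_out⟩`. -/
def ket {n : ℕ} {Uin Uout : Ensemble n} (z : Record Uin Uout) : Bits n × Bits n → ℂ :=
  fun w => ((Uin.U z.uIn).map star).mulVec (Pi.single z.bIn 1) w.1 *
    (Uout.U z.uOut).conjTranspose.mulVec (Pi.single z.bOut 1) w.2

/-- The projector `|z⟩⟨z|`. -/
def proj {n : ℕ} {Uin Uout : Ensemble n} (z : Record Uin Uout) : Op2 n :=
  Matrix.vecMulVec (ket z) (star (ket z))

/-- The measurement map
`A ↦ 𝔼_{U_in, U_out} ∑_{b_in, b_out} Tr(|z⟩⟨z| A) |z⟩⟨z|` with `z = (b_in, U_in, U_out, b_out)`. -/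
def measurementMap {n : ℕ} (Uin Uout : Ensemble n) : Module.End ℂ (Op2 n) :=
  ((Fintype.card Uin.Index : ℂ)⁻¹ * (Fintype.card Uout.Index : ℂ)⁻¹) •
    ∑ u : Uin.Index, ∑ v : Uout.Index, ∑ a : Bits n, ∑ b : Bits n,
      ((Matrix.traceLinearMap (Bits n × Bits n) ℂ ℂ) ∘ₗ
        (LinearMap.mulLeft ℂ (proj (Record.mk (Uin := Uin) (Uout := Uout) a u v b)))).smulRight
        (proj (Record.mk (Uin := Uin) (Uout := Uout) a u v b))

/-- The single-shot shadow of the Choi operator: the inverse of the measurement map, applied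
to `|z⟩⟨z|`. -/
def shadow {n : ℕ} {Uin Uout : Ensemble n} (z : Record Uin Uout) : Op2 n :=
  Ring.inverse (measurementMap Uin Uout) (proj z)

/-- The single-shot estimator of `Tr(E(ρ) O)`. The factor `2 ^ n` is the trace of the Choi
operator of a channel. -/
def estimator {n : ℕ} {Uin Uout : Ensemble n} (ρ O : Op n) (z : Record Uin Uout) : ℝ :=
  ((2 ^ n : ℂ) * (shadow z * (ρ.transpose ⊗ₖ O)).trace).re

/-- The median of `K` real numbers (the average of the two middle ones if `K` is even). -/
def median {K : ℕ} (x : Fin K → ℝ) : ℝ :=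
  if h : 0 < K then
    (x (Tuple.sort x ⟨(K - 1) / 2, by omega⟩) + x (Tuple.sort x ⟨K / 2, by omega⟩)) / 2
  else 0

/-- The median-of-means estimator, from `K` batches of `N` records each. -/
def medianOfMeans {n N K : ℕ} {Uin Uout : Ensemble n} (ρ O : Op n)
    (z : Fin K × Fin N → Record Uin Uout) : ℝ :=
  median fun k => (∑ i, estimator ρ O (z (k, i))) / N

/-! ### The quantities in the sample complexity -/

/-- The operator (spectral) norm. -/
def opNorm {n : ℕ} (A : Op n) : ℝ :=
  ‖Matrix.toEuclideanCLM (n := Bits n) (𝕜 := ℂ) A‖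

/-- `A` acts trivially on qubit `q`: it is the identity on qubit `q` tensored with an operator on
the other qubits. -/
def ActsTriviallyOn {n : ℕ} (A : Op n) (q : Fin n) : Prop :=
  ∀ x y : Bits n, (x q ≠ y q → A x y = 0) ∧
    (x q = y q → ∀ b : Fin 2, A (Function.update x q b) (Function.update y q b) = A x y)

/-- The number of qubits on which `A` acts nontrivially. -/
def suppSize {n : ℕ} (A : Op n) : ℕ :=
  {q : Fin n | ¬ ActsTriviallyOn A q}.ncard

/-- `S(A) = 2 ([2 Tr(A)² + Tr(A²)] I + 2 Tr(A) A + 2 A²)`. -/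
def S {n : ℕ} (A : Op n) : Op n :=
  (2 : ℂ) • ((2 * A.trace ^ 2 + (A ^ 2).trace) • (1 : Op n) + (2 * A.trace) • A + (2 : ℂ) • A ^ 2)

/-- The factor that an operator contributes to the sample complexity. -/
def f {n : ℕ} : EnsembleKind → Op n → ℝ
  | .localPauli, A => 4 ^ suppSize A * opNorm A ^ 2
  | .globalClifford, A => opNorm (S A)

end ShadowProcess

end

/-!
The proof rests on the fact that the states `U |b⟩⟨b| U†`, with `U` a uniformly random Clifford
unitary and all `b`, form a 3-design. Conjugation by a Clifford unitary permutes them, so their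
third moments `∑ Tr(φ A) Tr(φ B) Tr(φ C)` are Clifford invariant, and it suffices to evaluate them
on Pauli strings. Invariance under Pauli strings kills the moments of triples whose product is not
a multiple of the identity. The quarter turns `(1 + i P) / √2` act on Pauli strings as symplectic
transvections; they kill the moments of triples `P, Q, PQ` with `P`, `Q` anticommuting and show
that the remaining moments do not depend on the strings (`exists_sgn` gives the connecting string,
by counting signs). The two constants that are left follow from the purity of the states and
Parseval's identity. The result is `IsCliffordOrbit.moment_eq`. The families `U` and `U†` are both
needed, for the input and for the output; they are treated together as `CliffordInvariant`
families.

From this, each ensemble gives a frame of states (`IsShadowFrame`): every operator has an explicit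
preimage under the measurement map of one register, and the second moment of the expectation of
this preimage is bounded by `f A`, whatever state is measured. In the global case the preimage is
`(2 ^ n + 1) A - Tr(A)`, the second moment is an exact expression in `A`, and comparison with `S
A` leaves a sum of squares (`symTrace_preimage_le`). In the local case the measurement map is
diagonal in the Pauli basis, with eigenvalue `3 ^ (-|p|)` on `σ_p`. A product of stabilizer states
has a nonzero expectation on only one Pauli axis of each qubit, so the Cauchy–Schwarz inequality
costs a factor `4 ^ k` for an operator on `k` qubits and leaves the normalised Hilbert–Schmidt
norm, which is at most the operator norm (`isShadowFrame_localFamily`).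

The projector `|z⟩⟨z|` is the Kronecker product of the transposed input state and of the output
state, so the measurement map of the procedure factors over the two registers. It is therefore
invertible, and since it is self-adjoint for the trace form, the single-shot estimator is `2 ^ n
Tr(φ_in B) Tr(φ_out D)` with `B`, `D` the preimages of `ρ`, `O` (`estimator_eq`). It is unbiased,
and its second moment is at most `4 ^ n f(ρ) f(O)`: the output register is bounded for the state
`E(φ_in)`, the input register for the maximally mixed state.

By Chebyshev's inequality a batch mean fails with probability at most `1 / 34`. If the median
fails, at least half of the `K` independent batches fail; a union bound over the at most `2 ^ K`
sets of failing batches gives `2 ^ K 34 ^ (-K / 2) ≤ exp (-K / 2)`, because `4 e ≤ 34`. A union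
bound over the `M L` pairs leaves a total failure probability of at most `δ / 2`.
-/

noncomputable section

open scoped Kronecker ComplexOrder

namespace ShadowProcess

/-! ### Tensor products of single-qubit operators and the algebra of Pauli strings -/

/-- The product operator `a 0 ⊗ ⋯ ⊗ a (n-1)`. -/
def tensor {n : ℕ} (a : Fin n → Matrix (Fin 2) (Fin 2) ℂ) : Op n :=
  Matrix.of fun x y => ∏ i, a i (x i) (y i)

theorem tensor_mul {n : ℕ} (a b : Fin n → Matrix (Fin 2) (Fin 2) ℂ) :
    tensor a * tensor b = tensor fun i => a i * b i := by
  ext x y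
  simp only [tensor, Matrix.mul_apply, Matrix.of_apply, ← Finset.prod_mul_distrib]
  rw [Finset.prod_univ_sum, Fintype.piFinset_univ]

theorem trace_tensor {n : ℕ} (a : Fin n → Matrix (Fin 2) (Fin 2) ℂ) :
    (tensor a).trace = ∏ i, (a i).trace := by
  simp only [tensor, Matrix.trace, Matrix.of_apply, Matrix.diag_apply]
  rw [Finset.prod_univ_sum, Fintype.piFinset_univ]

theorem conjTranspose_tensor {n : ℕ} (a : Fin n → Matrix (Fin 2) (Fin 2) ℂ) :
    (tensor a).conjTranspose = tensor fun i => (a i).conjTranspose := by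
  ext x y
  simp [tensor, Matrix.conjTranspose_apply]

theorem tensor_smul {n : ℕ} (c : Fin n → ℂ) (a : Fin n → Matrix (Fin 2) (Fin 2) ℂ) :
    tensor (fun i => c i • a i) = (∏ i, c i) • tensor a := by
  ext x y
  simp [tensor, Finset.prod_mul_distrib]

theorem single_eq_tensor {n : ℕ} (x y : Bits n) :
    (Matrix.single x y 1 : Op n) = tensor fun i => Matrix.single (x i) (y i) 1 := by
  ext x' y'
  simp only [tensor, Matrix.of_apply, Matrix.single_apply]
  rw [Finset.prod_ite_zero]
  simp [funext_iff, forall_and]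

theorem tensor_one {n : ℕ} : tensor (fun _ : Fin n => 1) = 1 := by
  ext x y
  simp only [tensor, Matrix.of_apply, Matrix.one_apply]
  rw [Finset.prod_ite_zero]
  simp [funext_iff]

theorem pauliString_eq_tensor {n : ℕ} (p : Fin n → Fin 4) :
    pauliString p = tensor fun i => pauli (p i) := rfl

/-- The commutation sign of two single-qubit Pauli matrices. -/
def pauliSign (a b : Fin 4) : ℤ := if a = 0 ∨ b = 0 ∨ a = b then 1 else -1

theorem pauli_zero : pauli 0 = 1 := by
  ext i j
  fin_cases i <;> fin_cases j <;> simp [pauli]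

theorem pauli_mul_self (a : Fin 4) : pauli a * pauli a = 1 := by
  fin_cases a <;> ext i j <;> fin_cases i <;> fin_cases j <;> simp [pauli, Matrix.mul_apply]

theorem pauli_conjTranspose (a : Fin 4) : (pauli a).conjTranspose = pauli a := by
  fin_cases a <;> ext i j <;> fin_cases i <;> fin_cases j <;>
    simp [pauli, Matrix.conjTranspose_apply]

theorem pauli_trace (a : Fin 4) : (pauli a).trace = if a = 0 then 2 else 0 := by
  fin_cases a <;> simp [pauli, Matrix.trace_fin_two] <;> norm_num

theorem pauli_comm (a b : Fin 4) :
    pauli a * pauli b = (pauliSign a b : ℂ) • (pauli b * pauli a) := by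
  fin_cases a <;> fin_cases b <;> ext i j <;> fin_cases i <;> fin_cases j <;>
    simp [pauli, Matrix.mul_apply, pauliSign]

theorem pauli_mul (a b : Fin 4) : ∃ c : ℂ, pauli a * pauli b = c • pauli (a ^^^ b) := by
  have hx : a ^^^ b =
      (![![0, 1, 2, 3], ![1, 0, 3, 2], ![2, 3, 0, 1], ![3, 2, 1, 0]] : Fin 4 → Fin 4 → Fin 4)
        a b := by
    revert a b
    decide
  refine ⟨(![![1, 1, 1, 1], ![1, 1, Complex.I, -Complex.I], ![1, -Complex.I, 1, Complex.I],
    ![1, Complex.I, -Complex.I, 1]] : Fin 4 → Fin 4 → ℂ) a b, ?_⟩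
  rw [hx]
  fin_cases a <;> fin_cases b <;> ext i j <;> fin_cases i <;> fin_cases j <;>
    simp [pauli, Matrix.mul_apply]

variable {n : ℕ}

/-- The product of Pauli labels, i.e. of Pauli strings up to a phase. With the labelling
`I, X, Y, Z = 0, 1, 2, 3` it is the bitwise exclusive or. -/
def pmul (p q : Fin n → Fin 4) : Fin n → Fin 4 := fun i => p i ^^^ q i

theorem pmul_comm (p q : Fin n → Fin 4) : pmul p q = pmul q p := by
  funext i
  have : ∀ a b : Fin 4, a ^^^ b = b ^^^ a := by decide
  exact this _ _

theorem pmul_pmul_cancel (p q : Fin n → Fin 4) : pmul p (pmul p q) = q := by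
  funext i
  have : ∀ a b : Fin 4, a ^^^ (a ^^^ b) = b := by decide
  exact this _ _

theorem pmul_eq_zero {p q : Fin n → Fin 4} : pmul p q = 0 ↔ p = q := by
  have : ∀ a b : Fin 4, a ^^^ b = 0 ↔ a = b := by decide
  simp [funext_iff, pmul, this]

/-- The commutation sign of two Pauli strings. -/
def sgn (p q : Fin n → Fin 4) : ℤ := ∏ i, pauliSign (p i) (q i)

theorem sgn_comm (p q : Fin n → Fin 4) : sgn p q = sgn q p := by
  have : ∀ a b : Fin 4, pauliSign a b = pauliSign b a := by decide
  simp [sgn, fun i => this (p i) (q i)]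

theorem sgn_self (p : Fin n → Fin 4) : sgn p p = 1 := by
  simp [sgn, pauliSign]

theorem sgn_zero_right (p : Fin n → Fin 4) : sgn p 0 = 1 := by
  simp [sgn, pauliSign]

theorem sgn_pmul (p q r : Fin n → Fin 4) : sgn (pmul p q) r = sgn p r * sgn q r := by
  have : ∀ a b c : Fin 4, pauliSign (a ^^^ b) c = pauliSign a c * pauliSign b c := by decide
  simp [sgn, pmul, this, Finset.prod_mul_distrib]

theorem sgn_eq_or (p q : Fin n → Fin 4) : sgn p q = 1 ∨ sgn p q = -1 := by
  refine Finset.prod_induction _ (fun z : ℤ => z = 1 ∨ z = -1) ?_ (Or.inl rfl) fun i _ => ?_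
  · rintro a b (rfl | rfl) (rfl | rfl) <;> simp
  · have : ∀ a b : Fin 4, pauliSign a b = 1 ∨ pauliSign a b = -1 := by decide
    exact this _ _

theorem sum_sgn (p : Fin n → Fin 4) : ∑ r, sgn p r = if p = 0 then 4 ^ n else 0 := by
  have h : ∀ a : Fin 4, ∑ r, pauliSign a r = if a = 0 then 4 else 0 := by decide
  have h2 : (∏ i, ∑ r, pauliSign (p i) r) = ∑ r : Fin n → Fin 4, ∏ i, pauliSign (p i) (r i) := by
    rw [Finset.prod_univ_sum, Fintype.piFinset_univ]
  simp only [sgn]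
  rw [← h2]
  simp only [h]
  rw [Finset.prod_ite_zero]
  simp [funext_iff]

theorem pauliString_zero : pauliString (0 : Fin n → Fin 4) = 1 := by
  rw [pauliString_eq_tensor, ← tensor_one]
  simp [pauli_zero]

theorem pauliString_mul_self (p : Fin n → Fin 4) : pauliString p * pauliString p = 1 := by
  rw [pauliString_eq_tensor, tensor_mul]
  simp only [pauli_mul_self, tensor_one]

theorem pauliString_conjTranspose (p : Fin n → Fin 4) :
    (pauliString p).conjTranspose = pauliString p := by
  rw [pauliString_eq_tensor, conjTranspose_tensor]
  simp only [pauli_conjTranspose]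

theorem pauliString_trace (p : Fin n → Fin 4) :
    (pauliString p).trace = if p = 0 then (2 : ℂ) ^ n else 0 := by
  rw [pauliString_eq_tensor, trace_tensor]
  simp only [pauli_trace]
  rw [Finset.prod_ite_zero]
  simp [funext_iff]

theorem pauliString_comm (p q : Fin n → Fin 4) :
    pauliString p * pauliString q = (sgn p q : ℂ) • (pauliString q * pauliString p) := by
  simp only [pauliString_eq_tensor, tensor_mul]
  simp_rw [fun i => pauli_comm (p i) (q i)]
  rw [tensor_smul]
  simp [sgn]

theorem pauliString_mul (p q : Fin n → Fin 4) :
    ∃ c : ℂ, c ^ 2 = sgn p q ∧ pauliString p * pauliString q = c • pauliString (pmul p q) := by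
  choose c hc using fun i => pauli_mul (p i) (q i)
  have h : pauliString p * pauliString q = (∏ i, c i) • pauliString (pmul p q) := by
    simp only [pauliString_eq_tensor, tensor_mul, hc, tensor_smul, pmul]
  refine ⟨_, ?_, h⟩
  have h1 : (pauliString p * pauliString q) * (pauliString p * pauliString q) =
      (sgn p q : ℂ) • 1 := by
    conv_lhs => enter [1]; rw [pauliString_comm p q]
    rw [Matrix.smul_mul, Matrix.mul_assoc, ← Matrix.mul_assoc (pauliString p),
      pauliString_mul_self, Matrix.one_mul, pauliString_mul_self]
  rw [h, Matrix.smul_mul, Matrix.mul_smul, smul_smul, pauliString_mul_self] at h1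
  have h2 := congrFun (congrFun h1 (fun _ => 0)) (fun _ => 0)
  simpa [pow_two] using h2

theorem pauliString_trace_mul (p q : Fin n → Fin 4) :
    (pauliString p * pauliString q).trace = if p = q then (2 : ℂ) ^ n else 0 := by
  split_ifs with h
  · rw [h, pauliString_mul_self, ← pauliString_zero, pauliString_trace, if_pos rfl]
  · obtain ⟨c, -, hc⟩ := pauliString_mul p q
    rw [hc, Matrix.trace_smul, pauliString_trace, if_neg (fun h' => h (pmul_eq_zero.1 h')),
      smul_zero]

/-- Pauli strings span all operators. -/
theorem exists_eq_sum_pauliString (A : Op n) :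
    ∃ a : (Fin n → Fin 4) → ℂ, A = ∑ p, a p • pauliString p := by
  choose a ha using fun x y : Bits n => single_eq_sum_pauliString x y
  refine ⟨fun p => ∑ x, ∑ y, A x y * a x y p, ?_⟩
  conv_lhs => rw [Matrix.matrix_eq_sum_single A]
  have h : ∀ x y, Matrix.single x y (A x y) = ∑ p, (A x y * a x y p) • pauliString p :=
    fun x y => by
      rw [← mul_one (A x y), ← smul_eq_mul, ← Matrix.smul_single, ha, Finset.smul_sum]
      simp [smul_smul]
  simp only [h, Finset.sum_smul]
  rw [Finset.sum_comm' (t' := Finset.univ) (s' := fun _ => Finset.univ) (by simp)]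
  conv_rhs => rw [Finset.sum_comm]
  rw [Finset.sum_comm]
  refine Finset.sum_congr rfl fun x _ => ?_
  rw [Finset.sum_comm]

/-- The Pauli expansion of an operator. -/
theorem sum_trace_smul_pauliString (A : Op n) :
    ∑ p, (pauliString p * A).trace • pauliString p = (2 : ℂ) ^ n • A := by
  obtain ⟨a, rfl⟩ := exists_eq_sum_pauliString A
  simp only [Matrix.mul_sum, Matrix.trace_sum, Matrix.mul_smul, Matrix.trace_smul,
    pauliString_trace_mul, Finset.smul_sum, smul_smul]
  refine Finset.sum_congr rfl fun p _ => ?_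
  simp [mul_comm]

/-- Parseval's identity for the Pauli expansion. -/
theorem sum_trace_mul_trace (A B : Op n) :
    ∑ p, (pauliString p * A).trace * (pauliString p * B).trace = 2 ^ n * (A * B).trace := by
  have h := congrArg (fun X => (X * B).trace) (sum_trace_smul_pauliString A)
  simpa [Matrix.sum_mul, Matrix.trace_sum] using h

/-! ### The Clifford group -/

theorem IsClifford.conjTranspose_mul_self {U : Op n} (hU : IsClifford U) :
    U.conjTranspose * U = 1 := Matrix.mem_unitaryGroup_iff'.1 hU.1

theorem IsClifford.mul_conjTranspose_self {U : Op n} (hU : IsClifford U) :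
    U * U.conjTranspose = 1 := Matrix.mem_unitaryGroup_iff.1 hU.1

theorem sign_mul_sign (s : Bool) :
    (if s then (1 : ℂ) else -1) * (if s then (1 : ℂ) else -1) = 1 := by
  cases s <;> simp

theorem IsClifford.mul {U V : Op n} (hU : IsClifford U) (hV : IsClifford V) :
    IsClifford (U * V) := by
  refine ⟨mul_mem hU.1 hV.1, fun p => ?_⟩
  obtain ⟨s, q, h⟩ := hV.2 p
  obtain ⟨t, r, h'⟩ := hU.2 q
  refine ⟨s == t, r, ?_⟩
  calc U * V * pauliString p * (U * V).conjTranspose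
      = U * (V * pauliString p * V.conjTranspose) * U.conjTranspose := by
        rw [Matrix.conjTranspose_mul]
        simp only [Matrix.mul_assoc]
    _ = _ := by
        rw [h, Matrix.mul_smul, Matrix.smul_mul, h', smul_smul]
        cases s <;> cases t <;> simp

theorem eq_of_pauliString_eq_smul {p q : Fin n → Fin 4} {c : ℂ}
    (h : pauliString p = c • pauliString q) : p = q := by
  by_contra hpq
  have h1 := pauliString_trace_mul p p
  rw [if_pos rfl] at h1
  conv_lhs at h1 => enter [1, 2]; rw [h]
  rw [Matrix.mul_smul, Matrix.trace_smul, pauliString_trace_mul, if_neg hpq, smul_zero] at h1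
  exact pow_ne_zero n two_ne_zero h1.symm

/-- The inverse of a Clifford unitary is Clifford: conjugation permutes the finitely many Pauli
strings up to signs. -/
theorem IsClifford.conjTranspose {U : Op n} (hU : IsClifford U) : IsClifford U.conjTranspose := by
  have h1 := hU.conjTranspose_mul_self
  choose s q h using hU.2
  have hback : ∀ p, U.conjTranspose * pauliString (q p) * U =
      (if s p then (1 : ℂ) else -1) • pauliString p := fun p => by
    have h2 : pauliString (q p) =
        (if s p then (1 : ℂ) else -1) • (U * pauliString p * U.conjTranspose) := by
      rw [h, smul_smul, sign_mul_sign, one_smul]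
    rw [h2, Matrix.mul_smul, Matrix.smul_mul]
    congr 1
    calc U.conjTranspose * (U * pauliString p * U.conjTranspose) * U
        = (U.conjTranspose * U) * pauliString p * (U.conjTranspose * U) := by
          simp only [Matrix.mul_assoc]
      _ = _ := by rw [h1, Matrix.one_mul, Matrix.mul_one]
  have hinj : Function.Injective q := fun p p' hpp => by
    have h3 := hback p
    rw [hpp, hback p'] at h3
    refine eq_of_pauliString_eq_smul
      (c := (if s p then (1 : ℂ) else -1) * (if s p' then (1 : ℂ) else -1)) ?_
    rw [← smul_smul, h3, smul_smul, sign_mul_sign, one_smul]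
  refine ⟨Unitary.star_mem hU.1, fun p => ?_⟩
  obtain ⟨p0, rfl⟩ := (Finite.surjective_of_injective hinj) p
  exact ⟨s p0, p0, by rw [Matrix.conjTranspose_conjTranspose]; exact hback p0⟩

theorem pauliString_conj (t p : Fin n → Fin 4) :
    pauliString t * pauliString p * pauliString t = (sgn p t : ℂ) • pauliString p := by
  rw [Matrix.mul_assoc, pauliString_comm p t, Matrix.mul_smul, ← Matrix.mul_assoc,
    pauliString_mul_self, Matrix.one_mul]

theorem isClifford_pauliString (t : Fin n → Fin 4) : IsClifford (pauliString t) := by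
  refine ⟨Matrix.mem_unitaryGroup_iff.2 ?_, fun p => ⟨decide (sgn p t = 1), p, ?_⟩⟩
  · rw [Matrix.star_eq_conjTranspose, pauliString_conjTranspose, pauliString_mul_self]
  · rw [pauliString_conjTranspose, pauliString_conj]
    rcases sgn_eq_or p t with h | h <;> simp [h]

/-- The quarter turn `(1 + i σ_r) / √2`. On Pauli strings it acts as a symplectic transvection: it
fixes those that commute with `σ_r` and multiplies the others by `σ_r`, up to a phase. -/
def quarterTurn (r : Fin n → Fin 4) : Op n :=
  ((Real.sqrt 2 : ℂ)⁻¹) • (1 + Complex.I • pauliString r)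

theorem quarterTurn_conjTranspose (r : Fin n → Fin 4) :
    (quarterTurn r).conjTranspose =
      ((Real.sqrt 2 : ℂ)⁻¹) • (1 - Complex.I • pauliString r) := by
  simp [quarterTurn, Matrix.conjTranspose_smul, Matrix.conjTranspose_add,
    pauliString_conjTranspose, sub_eq_add_neg]

theorem inv_sqrt_two_sq : ((Real.sqrt 2 : ℂ)⁻¹) * ((Real.sqrt 2 : ℂ)⁻¹) = 1 / 2 := by
  rw [← mul_inv, ← Complex.ofReal_mul, Real.mul_self_sqrt (by norm_num)]
  norm_num

theorem I_smul_pauliString_sq (r : Fin n → Fin 4) :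
    (Complex.I • pauliString r) * (Complex.I • pauliString r) = -1 := by
  rw [Matrix.smul_mul, Matrix.mul_smul, smul_smul, Complex.I_mul_I, pauliString_mul_self,
    neg_one_smul]

theorem quarterTurn_mul_conjTranspose (r : Fin n → Fin 4) :
    quarterTurn r * (quarterTurn r).conjTranspose = 1 := by
  have h : ∀ X : Op n, (1 + X) * (1 - X) = 1 - X * X := fun X => by noncomm_ring
  rw [quarterTurn_conjTranspose, quarterTurn, Matrix.smul_mul, Matrix.mul_smul, smul_smul,
    inv_sqrt_two_sq, h, I_smul_pauliString_sq]
  module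

theorem quarterTurn_conj_of_comm {p r : Fin n → Fin 4} (h : sgn p r = 1) :
    quarterTurn r * pauliString p * (quarterTurn r).conjTranspose = pauliString p := by
  have hc : Commute (quarterTurn r) (pauliString p) := by
    have : Commute (pauliString r) (pauliString p) := by
      have := pauliString_comm p r
      rw [h, Int.cast_one, one_smul] at this
      exact this.symm
    exact ((Commute.one_left _).add_left (this.smul_left _)).smul_left _
  rw [hc.eq, Matrix.mul_assoc, quarterTurn_mul_conjTranspose, Matrix.mul_one]

theorem quarterTurn_conj_of_anticomm {p r : Fin n → Fin 4} (h : sgn p r = -1) :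
    quarterTurn r * pauliString p * (quarterTurn r).conjTranspose =
      (-Complex.I) • (pauliString p * pauliString r) := by
  have hc : pauliString r * pauliString p = -(pauliString p * pauliString r) := by
    have := pauliString_comm r p
    rw [sgn_comm, h] at this
    simpa using this
  have h2 : quarterTurn r * pauliString p =
      pauliString p * (quarterTurn r).conjTranspose := by
    rw [quarterTurn_conjTranspose, quarterTurn, Matrix.smul_mul, Matrix.mul_smul, Matrix.add_mul,
      Matrix.mul_sub, Matrix.smul_mul, Matrix.mul_smul, hc, Matrix.one_mul, Matrix.mul_one,
      smul_neg, sub_eq_add_neg]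
  have h3 : ∀ X : Op n, (1 - X) * (1 - X) = 1 - (X + X) + X * X := fun X => by noncomm_ring
  have h4 : (quarterTurn r).conjTranspose * (quarterTurn r).conjTranspose =
      (-Complex.I) • pauliString r := by
    rw [quarterTurn_conjTranspose, Matrix.smul_mul, Matrix.mul_smul, smul_smul, inv_sqrt_two_sq,
      h3, I_smul_pauliString_sq]
    module
  rw [h2, Matrix.mul_assoc, h4, Matrix.mul_smul]

theorem isClifford_quarterTurn (r : Fin n → Fin 4) : IsClifford (quarterTurn r) := by
  refine ⟨Matrix.mem_unitaryGroup_iff.2 (quarterTurn_mul_conjTranspose r), fun p => ?_⟩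
  rcases sgn_eq_or p r with h | h
  · exact ⟨true, p, by rw [quarterTurn_conj_of_comm h]; simp⟩
  · rw [quarterTurn_conj_of_anticomm h]
    obtain ⟨c, hc, hpr⟩ := pauliString_mul p r
    rw [hpr, smul_smul]
    have : (-Complex.I * c) ^ 2 = 1 := by
      rw [mul_pow, hc, h]
      simp
    rcases (sq_eq_sq_iff_eq_or_eq_neg.1 (this.trans (one_pow 2).symm)) with h1 | h1
    · exact ⟨true, pmul p r, by simp [h1]⟩
    · exact ⟨false, pmul p r, by simp [h1]⟩

/-! ### Families of unitaries on which the Clifford group acts -/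

/-- Left multiplication by a Clifford unitary permutes the family `W`, up to global phases. -/
def CliffordInvariant {ι : Type*} (W : ι → Op n) : Prop :=
  ∀ V : Op n, IsClifford V →
    ∃ π : Equiv.Perm ι, ∀ u, ∃ c : ℂ, ‖c‖ = 1 ∧ W (π u) = c • (V * W u)

theorem CliffordClass.isClifford_rep (c : CliffordClass n) : IsClifford c.rep :=
  (Quotient.out c).2

/-- The class of a Clifford unitary modulo global phases. -/
def CliffordClass.mk (U : Op n) (hU : IsClifford U) : CliffordClass n :=
  Quotient.mk (phaseSetoid n) ⟨U, hU⟩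

theorem CliffordClass.rep_mk (U : Op n) (hU : IsClifford U) :
    ∃ c : ℂ, ‖c‖ = 1 ∧ (CliffordClass.mk U hU).rep = c • U :=
  (phaseSetoid n).symm (Quotient.mk_out (s := phaseSetoid n) ⟨U, hU⟩)

theorem CliffordClass.eq_of_rep {c d : CliffordClass n} {z : ℂ} (hz : ‖z‖ = 1)
    (h : d.rep = z • c.rep) : c = d := by
  rw [← Quotient.out_eq c, ← Quotient.out_eq d]
  exact Quotient.sound ⟨z, hz, h⟩

theorem ne_zero_of_norm_eq_one {c : ℂ} (h : ‖c‖ = 1) : c ≠ 0 := by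
  rintro rfl
  simp at h

/-- A map on Clifford classes that multiplies representatives by a fixed invertible operator, up to
phases, is a permutation. -/
theorem cliffordInvariant_of_map (W : CliffordClass n → Op n)
    (hW : ∀ (c d : CliffordClass n) (z : ℂ), ‖z‖ = 1 → W d = z • W c → c = d)
    (h : ∀ V : Op n, IsClifford V → ∀ u, ∃ u', ∃ c : ℂ, ‖c‖ = 1 ∧ W u' = c • (V * W u)) :
    CliffordInvariant W := by
  intro V hV
  choose π c hc hπ using h V hV
  have hinj : Function.Injective π := fun u u' huu => by
    have h1 := hπ u
    rw [huu, hπ u'] at h1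
    have h2 := congrArg (fun X => V.conjTranspose * X) h1
    simp only [Matrix.mul_smul, ← Matrix.mul_assoc, hV.conjTranspose_mul_self,
      Matrix.one_mul] at h2
    refine hW u u' ((c u')⁻¹ * c u) (by simp [hc]) ?_
    rw [← smul_smul, ← h2, smul_smul, inv_mul_cancel₀ (ne_zero_of_norm_eq_one (hc u')), one_smul]
  exact ⟨Equiv.ofBijective π (Finite.injective_iff_bijective.1 hinj), fun u => ⟨c u, hc u, hπ u⟩⟩

theorem cliffordInvariant_rep :
    CliffordInvariant (CliffordClass.rep : CliffordClass n → Op n) :=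
  cliffordInvariant_of_map _ (fun _ _ _ hz h => CliffordClass.eq_of_rep hz h) fun V hV u =>
    ⟨_, CliffordClass.rep_mk (V * u.rep) (hV.mul u.isClifford_rep)⟩

theorem cliffordInvariant_conjTranspose_rep :
    CliffordInvariant (fun c : CliffordClass n => c.rep.conjTranspose) := by
  refine cliffordInvariant_of_map _ (fun c d z hz h => ?_) fun V hV u => ?_
  · refine CliffordClass.eq_of_rep (z := star z) (by simpa using hz) ?_
    have := congrArg Matrix.conjTranspose h
    simpa [Matrix.conjTranspose_smul] using this
  · obtain ⟨c, hc, h⟩ := CliffordClass.rep_mk (u.rep * V.conjTranspose)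
      (u.isClifford_rep.mul hV.conjTranspose)
    refine ⟨CliffordClass.mk _ (u.isClifford_rep.mul hV.conjTranspose), star c,
      by simpa using hc, ?_⟩
    rw [h, Matrix.conjTranspose_smul, Matrix.conjTranspose_mul, Matrix.conjTranspose_conjTranspose]

/-- The pure state `W_u |b⟩⟨b| W_u†`. -/
def state {ι : Type*} (W : ι → Op n) (u : ι) (b : Bits n) : Op n :=
  W u * Matrix.single b b 1 * (W u).conjTranspose

theorem CliffordInvariant.exists_state {ι : Type*} {W : ι → Op n} (hW : CliffordInvariant W)
    {V : Op n} (hV : IsClifford V) :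
    ∃ π : Equiv.Perm ι, ∀ u b, state W (π u) b = V * state W u b * V.conjTranspose := by
  obtain ⟨π, h⟩ := hW V hV
  refine ⟨π, fun u b => ?_⟩
  obtain ⟨c, hc, hu⟩ := h u
  have hcc : c * star c = 1 := by
    rw [Complex.star_def, Complex.mul_conj, Complex.normSq_eq_norm_sq, hc]
    simp
  rw [state, hu, Matrix.conjTranspose_smul, Matrix.conjTranspose_mul, Matrix.smul_mul,
    Matrix.smul_mul, Matrix.mul_smul, smul_smul, hcc, one_smul, state]
  simp only [Matrix.mul_assoc]

theorem trace_single_mul (x y : Bits n) (A : Op n) : (Matrix.single x y 1 * A).trace = A y x := by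
  simp [Matrix.trace_single_mul]

theorem trace_state_mul {ι : Type*} (W : ι → Op n) (u : ι) (b : Bits n) (A : Op n) :
    (state W u b * A).trace = ((W u).conjTranspose * A * W u) b b := by
  rw [state, Matrix.mul_assoc, Matrix.mul_assoc, Matrix.trace_mul_comm, Matrix.mul_assoc,
    trace_single_mul, Matrix.mul_assoc]

/-- A pure state has rank one. -/
theorem state_mul_mul_state {ι : Type*} (W : ι → Op n) (u : ι) (b : Bits n) (A : Op n) :
    state W u b * A * state W u b = (state W u b * A).trace • state W u b := by
  rw [trace_state_mul]
  have : ∀ X : Op n, Matrix.single b b 1 * X * Matrix.single b b 1 =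
      X b b • (Matrix.single b b 1 : Op n) := fun X => by
    simp [Matrix.single_mul_mul_single, Matrix.smul_single]
  calc state W u b * A * state W u b
      = W u * (Matrix.single b b 1 * ((W u).conjTranspose * A * W u) * Matrix.single b b 1) *
        (W u).conjTranspose := by simp only [state, Matrix.mul_assoc]
    _ = _ := by rw [this, Matrix.mul_smul, Matrix.smul_mul, state]

theorem trace_state {ι : Type*} {W : ι → Op n} {u : ι}
    (hW : W u ∈ Matrix.unitaryGroup (Bits n) ℂ) (b : Bits n) : (state W u b).trace = 1 := by
  rw [← Matrix.mul_one (state W u b), trace_state_mul, Matrix.mul_one,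
    ← Matrix.star_eq_conjTranspose, Matrix.mem_unitaryGroup_iff'.1 hW, Matrix.one_apply_eq]

theorem state_posSemidef {ι : Type*} (W : ι → Op n) (u : ι) (b : Bits n) :
    (state W u b).PosSemidef := by
  have : (Matrix.single b b (1 : ℂ) : Op n).PosSemidef := by
    rw [← Matrix.diagonal_single]
    refine Matrix.PosSemidef.diagonal fun x => ?_
    by_cases h : x = b
    · subst h; simp
    · simp [h]
  exact this.mul_mul_conjTranspose_same _

/-! ### Clifford orbits of pure states are 3-designs -/

/-- A finite family of rank-one projectors that is permuted by conjugation with any Clifford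
unitary. -/
structure IsCliffordOrbit {J : Type*} (φ : J → Op n) : Prop where
  trace_eq_one : ∀ j, (φ j).trace = 1
  rank_one : ∀ j A, φ j * A * φ j = (φ j * A).trace • φ j
  invariant : ∀ V : Op n, IsClifford V →
    ∃ π : Equiv.Perm J, ∀ j, φ (π j) = V * φ j * V.conjTranspose

/-- The third moment `∑ⱼ Tr(φⱼ A) Tr(φⱼ B) Tr(φⱼ C)` of a family of states. -/
def moment {J : Type*} [Fintype J] (φ : J → Op n) (A B C : Op n) : ℂ :=
  ∑ j, (φ j * A).trace * (φ j * B).trace * (φ j * C).trace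

/-- The sum over all permutations of three copies that gives the third moment of a 3-design. -/
def symTrace (A B C : Op n) : ℂ :=
  A.trace * B.trace * C.trace + (A * B).trace * C.trace + (A * C).trace * B.trace +
    (B * C).trace * A.trace + (A * B * C).trace + (A * C * B).trace

theorem moment_rotate {J : Type*} [Fintype J] (φ : J → Op n) (A B C : Op n) :
    moment φ A B C = moment φ B C A :=
  Finset.sum_congr rfl fun _ _ => by ring

theorem moment_swap {J : Type*} [Fintype J] (φ : J → Op n) (A B C : Op n) :
    moment φ A B C = moment φ B A C :=
  Finset.sum_congr rfl fun _ _ => by ring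

theorem moment_smul {J : Type*} [Fintype J] (φ : J → Op n) (a b c : ℂ) (A B C : Op n) :
    moment φ (a • A) (b • B) (c • C) = a * b * c * moment φ A B C := by
  simp only [moment, Matrix.mul_smul, Matrix.trace_smul, smul_eq_mul, Finset.mul_sum]
  exact Finset.sum_congr rfl fun _ _ => by ring

theorem symTrace_rotate (A B C : Op n) : symTrace A B C = symTrace B C A := by
  have h1 : (A * B * C).trace = (B * C * A).trace := by
    rw [Matrix.mul_assoc, Matrix.trace_mul_comm]
  have h2 : (A * C * B).trace = (B * A * C).trace := by
    rw [Matrix.trace_mul_comm, Matrix.mul_assoc]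
  rw [symTrace, symTrace, h1, h2, Matrix.trace_mul_comm A B, Matrix.trace_mul_comm A C]
  ring

/-- There is a Pauli string that commutes with `p` and anticommutes with `q` and `q'`. The strings
in question are counted by expanding `∑_r (1 + sgn p r) (1 - sgn q r) (1 - sgn q' r)`. -/
theorem exists_sgn {p q q' : Fin n → Fin 4} (hq : q ≠ 0) (hq' : q' ≠ 0) (hpq : p ≠ q)
    (hpq' : p ≠ q') : ∃ r, sgn p r = 1 ∧ sgn q r = -1 ∧ sgn q' r = -1 := by
  by_contra! hcon
  have hzero : ∑ r, (1 + sgn p r) * (1 - sgn q r) * (1 - sgn q' r) = 0 := by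
    refine Finset.sum_eq_zero fun r _ => ?_
    rcases sgn_eq_or p r with h1 | h1 <;> rcases sgn_eq_or q r with h2 | h2 <;>
      rcases sgn_eq_or q' r with h3 | h3 <;> simp [h1, h2, h3]
    exact hcon r h1 h2 h3
  have hexp : ∑ r, (1 + sgn p r) * (1 - sgn q r) * (1 - sgn q' r) =
      ∑ r, sgn (0 : Fin n → Fin 4) r + ∑ r, sgn p r - ∑ r, sgn q r - ∑ r, sgn q' r +
        ∑ r, sgn (pmul q q') r - ∑ r, sgn (pmul p q) r - ∑ r, sgn (pmul p q') r +
        ∑ r, sgn (pmul p (pmul q q')) r := by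
    simp only [← Finset.sum_add_distrib, ← Finset.sum_sub_distrib]
    refine Finset.sum_congr rfl fun r _ => ?_
    simp only [sgn_pmul, sgn_comm 0 r, sgn_zero_right]
    ring
  rw [hexp] at hzero
  simp only [sum_sgn, pmul_eq_zero, hq, hq', hpq, hpq', if_false, if_true] at hzero
  have h4 : (0 : ℤ) < 4 ^ n := by positivity
  split_ifs at hzero <;> linarith

/-- Every nontrivial Pauli string anticommutes with some Pauli string. -/
theorem exists_sgn_eq_neg_one {p : Fin n → Fin 4} (hp : p ≠ 0) : ∃ r, sgn p r = -1 := by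
  obtain ⟨r, -, hr, -⟩ := exists_sgn hp hp hp.symm hp.symm
  exact ⟨r, hr⟩

theorem quarterTurn_conj_eq_smul {p r : Fin n → Fin 4} (h : sgn p r = -1) :
    ∃ ε : ℂ, ε * ε = 1 ∧ quarterTurn r * pauliString p * (quarterTurn r).conjTranspose =
      ε • pauliString (pmul p r) := by
  obtain ⟨c, hc, hpr⟩ := pauliString_mul p r
  refine ⟨-Complex.I * c, ?_, by rw [quarterTurn_conj_of_anticomm h, hpr, smul_smul]⟩
  rw [h] at hc
  calc -Complex.I * c * (-Complex.I * c) = (Complex.I * Complex.I) * c ^ 2 := by ring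
    _ = 1 := by simp [hc]

namespace IsCliffordOrbit

variable {J : Type*} {φ : J → Op n}

theorem mul_self (h : IsCliffordOrbit φ) (j : J) : φ j * φ j = φ j := by
  have := h.rank_one j 1
  rwa [Matrix.mul_one, h.trace_eq_one, one_smul] at this

variable [Fintype J]

/-- Conjugating all three arguments by a Clifford unitary only permutes the terms of the sum. -/
theorem moment_conj (h : IsCliffordOrbit φ) {V : Op n} (hV : IsClifford V) (A B C : Op n) :
    moment φ (V * A * V.conjTranspose) (V * B * V.conjTranspose) (V * C * V.conjTranspose) =
      moment φ A B C := by
  obtain ⟨π, hπ⟩ := h.invariant V hV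
  have key : ∀ j A, (φ (π j) * (V * A * V.conjTranspose)).trace = (φ j * A).trace := fun j A => by
    rw [hπ, show V * φ j * V.conjTranspose * (V * A * V.conjTranspose) =
      V * (φ j * (V.conjTranspose * V) * A * V.conjTranspose) by simp only [Matrix.mul_assoc],
      hV.conjTranspose_mul_self, Matrix.mul_one, Matrix.trace_mul_comm, Matrix.mul_assoc,
      hV.conjTranspose_mul_self, Matrix.mul_one]
  rw [moment, ← Equiv.sum_comp π]
  simp only [key, moment]

/-- The conjugation of a pair of Pauli strings by the quarter turn `r = q q'` takes `q` to `q'`, and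
fixes `p` when `p` commutes with both. -/
theorem moment_pair_eq_of_anticomm (h : IsCliffordOrbit φ) {p q q' : Fin n → Fin 4}
    (hpq : sgn p q = 1) (hpq' : sgn p q' = 1) (hqq' : sgn q q' = -1) :
    moment φ (pauliString p) (pauliString q) (pauliString p * pauliString q) =
      moment φ (pauliString p) (pauliString q') (pauliString p * pauliString q') := by
  have hq : sgn q (pmul q q') = -1 := by rw [sgn_comm, sgn_pmul, sgn_self, sgn_comm q', hqq']; rfl
  have hp : sgn p (pmul q q') = 1 := by
    rw [sgn_comm, sgn_pmul, sgn_comm q, sgn_comm q', hpq, hpq']; rfl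
  obtain ⟨ε, hε, hV⟩ := quarterTurn_conj_eq_smul hq
  rw [pmul_pmul_cancel] at hV
  have hVp := quarterTurn_conj_of_comm hp
  have hcl := isClifford_quarterTurn (pmul q q')
  set V := quarterTurn (pmul q q')
  have hVpq : V * (pauliString p * pauliString q) * V.conjTranspose =
      ε • (pauliString p * pauliString q') := by
    calc V * (pauliString p * pauliString q) * V.conjTranspose
        = V * pauliString p * (V.conjTranspose * V) * pauliString q * V.conjTranspose := by
          rw [hcl.conjTranspose_mul_self, Matrix.mul_one]; simp only [Matrix.mul_assoc]
      _ = (V * pauliString p * V.conjTranspose) * (V * pauliString q * V.conjTranspose) := by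
          simp only [Matrix.mul_assoc]
      _ = _ := by rw [hVp, hV, Matrix.mul_smul]
  rw [← h.moment_conj hcl, hVp, hV, hVpq]
  conv_lhs => enter [2]; rw [← one_smul ℂ (pauliString p)]
  rw [moment_smul, one_mul, hε, one_mul]

/-- Two admissible `q`, `q'` are linked by a string that commutes with `p` and anticommutes with
both. -/
theorem moment_pair_const (h : IsCliffordOrbit φ) {p q q' : Fin n → Fin 4}
    (hpq : sgn p q = 1) (hpq' : sgn p q' = 1) (hq : q ≠ 0) (hq' : q' ≠ 0) (hne : p ≠ q)
    (hne' : p ≠ q') :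
    moment φ (pauliString p) (pauliString q) (pauliString p * pauliString q) =
      moment φ (pauliString p) (pauliString q') (pauliString p * pauliString q') := by
  obtain ⟨r, h1, h2, h3⟩ := exists_sgn hq hq' hne hne'
  rw [h.moment_pair_eq_of_anticomm hpq h1 h2,
    h.moment_pair_eq_of_anticomm h1 hpq' (by rw [sgn_comm, h3])]

/-- For anticommuting `P`, `Q` the quarter turn about `P` fixes `P` and exchanges `Q` and `i P Q`
up to sign; this reverses the sign of the moment. -/
theorem moment_pair_of_anticomm (h : IsCliffordOrbit φ) {p q : Fin n → Fin 4}
    (hpq : sgn p q = -1) :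
    moment φ (pauliString p) (pauliString q) (pauliString p * pauliString q) = 0 := by
  have hVp := quarterTurn_conj_of_comm (sgn_self p)
  have hVq := quarterTurn_conj_of_anticomm (p := q) (r := p) (by rw [sgn_comm, hpq])
  have hcl := isClifford_quarterTurn p
  have hc : pauliString q * pauliString p = (-1 : ℂ) • (pauliString p * pauliString q) := by
    have := pauliString_comm q p
    rw [sgn_comm, hpq] at this
    simpa using this
  set V := quarterTurn p
  have hVpq : V * (pauliString p * pauliString q) * V.conjTranspose =
      Complex.I • pauliString q := by
    calc V * (pauliString p * pauliString q) * V.conjTranspose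
        = V * pauliString p * (V.conjTranspose * V) * pauliString q * V.conjTranspose := by
          rw [hcl.conjTranspose_mul_self, Matrix.mul_one]; simp only [Matrix.mul_assoc]
      _ = (V * pauliString p * V.conjTranspose) * (V * pauliString q * V.conjTranspose) := by
          simp only [Matrix.mul_assoc]
      _ = _ := by
          rw [hVp, hVq, hc, smul_smul, Matrix.mul_smul, ← Matrix.mul_assoc, pauliString_mul_self,
            Matrix.one_mul]
          congr 1
          ring
  have h1 := h.moment_conj hcl (pauliString p) (pauliString q) (pauliString p * pauliString q)
  rw [hVp, hVq, hVpq, hc, smul_smul, ← one_smul ℂ (pauliString p), moment_smul, one_smul,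
    moment_rotate, moment_swap, ← moment_rotate] at h1
  have h2 : (1 : ℂ) * (-Complex.I * -1) * Complex.I = -1 := by
    rw [one_mul, neg_mul_neg, mul_one, Complex.I_mul_I]
  rw [h2] at h1
  linear_combination (-1 / 2 : ℂ) * h1

/-- The quarter turn about `p q` takes `p` to `q` up to sign, and the sign enters twice. -/
theorem moment_self_eq_of_anticomm (h : IsCliffordOrbit φ) {p q : Fin n → Fin 4}
    (hpq : sgn p q = -1) :
    moment φ (pauliString p) (pauliString p) 1 = moment φ (pauliString q) (pauliString q) 1 := by
  have hp : sgn p (pmul p q) = -1 := by rw [sgn_comm, sgn_pmul, sgn_self, sgn_comm q, hpq]; rfl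
  obtain ⟨ε, hε, hV⟩ := quarterTurn_conj_eq_smul hp
  rw [pmul_pmul_cancel] at hV
  have hcl := isClifford_quarterTurn (pmul p q)
  rw [← h.moment_conj hcl, hV, Matrix.mul_one, hcl.mul_conjTranspose_self,
    ← one_smul ℂ (1 : Op n), moment_smul, hε, one_smul, one_mul, one_mul]

/-- Any two nontrivial Pauli strings anticommute with a common third one, which links their
moments. -/
theorem moment_self_const (h : IsCliffordOrbit φ) {p q : Fin n → Fin 4} (hp : p ≠ 0)
    (hq : q ≠ 0) :
    moment φ (pauliString p) (pauliString p) 1 = moment φ (pauliString q) (pauliString q) 1 := by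
  obtain ⟨r, -, h2, h3⟩ := exists_sgn hp hq hp.symm hq.symm
  rw [h.moment_self_eq_of_anticomm h2, h.moment_self_eq_of_anticomm (by rw [sgn_comm, h3])]

theorem moment_one (h : IsCliffordOrbit φ) : moment φ 1 1 1 = Fintype.card J := by
  simp [moment, h.trace_eq_one]

/-- By Parseval's identity the sum is governed by the purity `Tr(φ²) = 1` of the states. -/
theorem sum_moment_self (h : IsCliffordOrbit φ) :
    ∑ p, moment φ (pauliString p) (pauliString p) 1 = 2 ^ n * Fintype.card J := by
  simp only [moment]
  rw [Finset.sum_comm]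
  have : ∀ j, ∑ p, (φ j * pauliString p).trace * (φ j * pauliString p).trace * (φ j * 1).trace =
      2 ^ n := fun j => by
    have h1 := sum_trace_mul_trace (φ j) (φ j)
    rw [h.mul_self, h.trace_eq_one, mul_one] at h1
    rw [← h1]
    refine Finset.sum_congr rfl fun p _ => ?_
    rw [Matrix.mul_one, h.trace_eq_one, mul_one, Matrix.trace_mul_comm]
  simp only [this, Finset.sum_const, Finset.card_univ, nsmul_eq_mul]
  ring

/-- Parseval's identity for `φ` and `φ P`, together with `φ² = φ`. -/
theorem sum_moment_pair (h : IsCliffordOrbit φ) (p : Fin n → Fin 4) :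
    ∑ q, moment φ (pauliString p) (pauliString q) (pauliString p * pauliString q) =
      2 ^ n * moment φ (pauliString p) (pauliString p) 1 := by
  simp only [moment]
  rw [Finset.sum_comm, Finset.mul_sum]
  refine Finset.sum_congr rfl fun j _ => ?_
  have h1 := sum_trace_mul_trace (φ j) (φ j * pauliString p)
  rw [← Matrix.mul_assoc, h.mul_self] at h1
  rw [Matrix.mul_one, h.trace_eq_one, mul_one, mul_left_comm, ← h1, Finset.mul_sum]
  refine Finset.sum_congr rfl fun q _ => ?_
  rw [mul_assoc, Matrix.trace_mul_comm (φ j) (pauliString q), ← Matrix.mul_assoc,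
    Matrix.trace_mul_comm (φ j * pauliString p)]

/-- The `4 ^ n - 1` nontrivial Pauli strings share the total that purity leaves for them. -/
theorem moment_self (h : IsCliffordOrbit φ) {p : Fin n → Fin 4} (hp : p ≠ 0) :
    (2 ^ n + 1) * moment φ (pauliString p) (pauliString p) 1 = Fintype.card J := by
  have h1 := h.sum_moment_self
  obtain ⟨η, hη⟩ : ∃ η, moment φ (pauliString p) (pauliString p) 1 = η := ⟨_, rfl⟩
  rw [hη]
  have h2 : ∀ q : Fin n → Fin 4, moment φ (pauliString q) (pauliString q) 1 =
      η + if q = 0 then (Fintype.card J : ℂ) - η else 0 := fun q => by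
    split_ifs with hq
    · rw [hq, pauliString_zero, h.moment_one]
      ring
    · rw [add_zero, h.moment_self_const hq hp, hη]
  simp_rw [h2] at h1
  rw [Finset.sum_add_distrib, Finset.sum_ite_eq' Finset.univ, if_pos (Finset.mem_univ _),
    Finset.sum_const, Finset.card_univ, Fintype.card_pi_const, Fintype.card_fin, nsmul_eq_mul] at h1
  push_cast at h1
  rw [show (4 : ℂ) = 2 ^ 2 by norm_num, ← pow_mul, mul_comm 2 n, pow_mul] at h1
  have hn : n ≠ 0 := by
    rintro rfl
    exact hp (Subsingleton.elim _ _)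
  have hd : (2 ^ n - 1 : ℂ) ≠ 0 := by
    rw [sub_ne_zero]
    exact_mod_cast (Nat.one_lt_two_pow hn).ne'
  refine mul_left_cancel₀ hd ?_
  linear_combination h1

/-- On a single qubit distinct nontrivial Pauli matrices anticommute. This excludes `2 ^ n = 2`, the
one dimension in which the count of commuting strings cannot be divided out. -/
theorem ne_of_sgn_eq_one {p q : Fin n → Fin 4} (hp : p ≠ 0) (hq : q ≠ 0) (hpq : p ≠ q)
    (hs : sgn p q = 1) : (2 : ℂ) ^ n ≠ 2 := by
  intro hd
  have hn : n = 1 := by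
    have : (2 : ℕ) ^ n = 2 ^ 1 := by exact_mod_cast hd
    exact Nat.pow_right_injective le_rfl this
  subst hn
  have key : ∀ a b : Fin 4, a ≠ 0 → b ≠ 0 → a ≠ b → pauliSign a b ≠ 1 := by decide
  have hext : ∀ r s : Fin 1 → Fin 4, r 0 = s 0 → r = s := fun r s h => by
    funext i
    rwa [Subsingleton.elim i 0]
  refine key (p 0) (q 0) (fun h => hp (hext _ _ h)) (fun h => hq (hext _ _ h))
    (fun h => hpq (hext _ _ h)) ?_
  simpa [sgn] using hs

/-- For fixed `P` the strings that anticommute with `P` contribute nothing, and the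
`4 ^ n / 2 - 2` nontrivial commuting ones other than `P` contribute equally to the total of
`sum_moment_pair`. -/
theorem moment_pair (h : IsCliffordOrbit φ) {p q : Fin n → Fin 4} (hp : p ≠ 0) (hq : q ≠ 0)
    (hpq : p ≠ q) (hs : sgn p q = 1) :
    (2 ^ n + 2) * moment φ (pauliString p) (pauliString q) (pauliString p * pauliString q) =
      2 * moment φ (pauliString p) (pauliString p) 1 := by
  have h1 := h.sum_moment_pair p
  set η := moment φ (pauliString p) (pauliString p) 1 with hη
  set γ := moment φ (pauliString p) (pauliString q) (pauliString p * pauliString q) with hγ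
  have h2 : ∀ r : Fin n → Fin 4,
      moment φ (pauliString p) (pauliString r) (pauliString p * pauliString r) =
      (1 + (sgn p r : ℂ)) * (γ / 2) + (if r = 0 then η - γ else 0) +
        if r = p then η - γ else 0 := fun r => by
    by_cases hr : r = 0
    · subst hr
      rw [pauliString_zero, Matrix.mul_one, ← moment_rotate, ← hη, if_pos rfl,
        if_neg hp.symm, sgn_zero_right]
      push_cast
      ring
    by_cases hrp : r = p
    · subst hrp
      rw [pauliString_mul_self, ← hη, if_neg hp, if_pos rfl, sgn_self]
      push_cast
      ring
    rw [if_neg hr, if_neg hrp]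
    rcases sgn_eq_or p r with h3 | h3
    · rw [h.moment_pair_const h3 hs hr hq (Ne.symm hrp) hpq, h3]
      push_cast
      ring
    · rw [h.moment_pair_of_anticomm h3, h3]
      push_cast
      ring
  simp_rw [h2] at h1
  rw [Finset.sum_add_distrib, Finset.sum_add_distrib, ← Finset.sum_mul, Finset.sum_add_distrib,
    Finset.sum_ite_eq' Finset.univ, if_pos (Finset.mem_univ _), Finset.sum_ite_eq' Finset.univ,
    if_pos (Finset.mem_univ _), ← Int.cast_sum, sum_sgn, if_neg hp,
    Finset.sum_const, Finset.card_univ, Fintype.card_pi_const, Fintype.card_fin, nsmul_eq_mul] at h1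
  push_cast at h1
  rw [show (4 : ℂ) = 2 ^ 2 by norm_num, ← pow_mul, mul_comm 2 n, pow_mul] at h1
  refine mul_left_cancel₀ (sub_ne_zero.2 (ne_of_sgn_eq_one hp hq hpq hs)) ?_
  linear_combination 2 * h1

/-- The 3-design identity on Pauli strings whose product is a multiple of the identity. -/
theorem moment_pauliString_pair (h : IsCliffordOrbit φ) (p q : Fin n → Fin 4) :
    (2 ^ n * (2 ^ n + 1) * (2 ^ n + 2)) *
        moment φ (pauliString p) (pauliString q) (pauliString p * pauliString q) =
      Fintype.card J *
        symTrace (pauliString p) (pauliString q) (pauliString p * pauliString q) := by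
  have hQPQ : pauliString q * (pauliString p * pauliString q) =
      (sgn p q : ℂ) • pauliString p := by
    rw [← Matrix.mul_assoc, pauliString_conj]
  have e1 : pauliString p * (pauliString p * pauliString q) = pauliString q := by
    rw [← Matrix.mul_assoc, pauliString_mul_self, Matrix.one_mul]
  have e2 : pauliString p * pauliString q * (pauliString p * pauliString q) =
      (sgn p q : ℂ) • 1 := by
    rw [Matrix.mul_assoc, hQPQ, Matrix.mul_smul, pauliString_mul_self]
  rw [symTrace, hQPQ, e1, e2, pauliString_mul_self, Matrix.trace_smul, Matrix.trace_smul,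
    pauliString_trace_mul, pauliString_trace, pauliString_trace, ← pauliString_zero,
    pauliString_trace, if_pos rfl]
  by_cases hp : p = 0
  · subst hp
    rw [pauliString_zero, Matrix.one_mul, moment_rotate, sgn_comm, sgn_zero_right]
    by_cases hq : q = 0
    · subst hq
      rw [pauliString_zero, h.moment_one]
      simp
      ring
    · have := h.moment_self hq
      simp [hq, Ne.symm hq]
      linear_combination (2 ^ n * (2 ^ n + 2)) * this
  by_cases hq : q = 0
  · subst hq
    have := h.moment_self hp
    rw [pauliString_zero, Matrix.mul_one, ← moment_rotate, sgn_zero_right]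
    simp [hp]
    linear_combination (2 ^ n * (2 ^ n + 2)) * this
  by_cases hpq : p = q
  · subst hpq
    have := h.moment_self hp
    rw [pauliString_mul_self, sgn_self]
    simp [hp]
    linear_combination (2 ^ n * (2 ^ n + 2)) * this
  rcases sgn_eq_or p q with hs | hs
  · have h1 := h.moment_self hp
    have h2 := h.moment_pair hp hq hpq hs
    simp [hp, hq, hpq, hs]
    linear_combination (2 ^ n * (2 ^ n + 1)) * h2 + 2 * 2 ^ n * h1
  · rw [h.moment_pair_of_anticomm hs]
    simp [hp, hq, hpq, hs]

/-- The 3-design identity on Pauli strings. If the product of the three is not a multiple of the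
identity, both sides vanish. -/
theorem moment_pauliString (h : IsCliffordOrbit φ) (p q r : Fin n → Fin 4) :
    (2 ^ n * (2 ^ n + 1) * (2 ^ n + 2)) *
        moment φ (pauliString p) (pauliString q) (pauliString r) =
      Fintype.card J * symTrace (pauliString p) (pauliString q) (pauliString r) := by
  obtain ⟨c, hc, hpq⟩ := pauliString_mul p q
  have hc0 : c ≠ 0 := by
    rintro rfl
    rcases sgn_eq_or p q with h1 | h1 <;> simp [h1] at hc
  by_cases hr : r = pmul p q
  · have hR : pauliString r = c⁻¹ • (pauliString p * pauliString q) := by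
      rw [hpq, smul_smul, inv_mul_cancel₀ hc0, one_smul, hr]
    have h1 := h.moment_pauliString_pair p q
    have h2 : ∀ A B C : Op n, symTrace A B (c⁻¹ • C) = c⁻¹ * symTrace A B C := fun A B C => by
      simp only [symTrace, Matrix.mul_smul, Matrix.smul_mul, Matrix.trace_smul, smul_eq_mul]
      ring
    have h3 : ∀ A B C : Op n, moment φ A B (c⁻¹ • C) = c⁻¹ * moment φ A B C := fun A B C => by
      have := moment_smul φ 1 1 c⁻¹ A B C
      rwa [one_smul, one_smul, one_mul, one_mul] at this
    rw [hR, h2, h3]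
    linear_combination c⁻¹ * h1
  · -- a Pauli string that anticommutes with the product of the three reverses the sign
    obtain ⟨t, ht⟩ := exists_sgn_eq_neg_one (p := pmul r (pmul p q))
      (fun h' => hr (pmul_eq_zero.1 h'))
    have h1 := h.moment_conj (isClifford_pauliString t) (pauliString p) (pauliString q)
      (pauliString r)
    simp only [pauliString_conjTranspose, pauliString_conj, moment_smul] at h1
    have hsg : (sgn p t : ℂ) * sgn q t * sgn r t = -1 := by
      rw [sgn_pmul, sgn_pmul] at ht
      have : ((sgn r t * (sgn p t * sgn q t) : ℤ) : ℂ) = ((-1 : ℤ) : ℂ) := by rw [ht]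
      push_cast at this
      linear_combination this
    rw [hsg] at h1
    have hm : moment φ (pauliString p) (pauliString q) (pauliString r) = 0 := by
      linear_combination (-1 / 2 : ℂ) * h1
    have t1 : (pauliString p * pauliString q * pauliString r).trace = 0 := by
      rw [hpq, Matrix.smul_mul, Matrix.trace_smul, pauliString_trace_mul, if_neg (Ne.symm hr),
        smul_zero]
    have t2 : (pauliString p * pauliString r * pauliString q).trace = 0 := by
      rw [Matrix.mul_assoc, pauliString_comm r q, Matrix.mul_smul, Matrix.trace_smul,
        ← Matrix.mul_assoc, t1, smul_zero]
    have t3 : ∀ a b : Fin n → Fin 4, pmul 0 a = a ∧ (a = b → pmul a b = 0) ∧ pmul a 0 = a :=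
      fun a b => by
        have h0 := pmul_pmul_cancel a a
        rw [pmul_eq_zero.2 rfl] at h0
        exact ⟨by rw [pmul_comm, h0], pmul_eq_zero.2, h0⟩
    rw [hm, symTrace, t1, t2]
    simp only [pauliString_trace_mul, pauliString_trace]
    by_cases hp : p = 0
    · subst hp
      rw [(t3 q q).1] at hr
      by_cases hq : q = 0
      · subst hq; simp [hr, Ne.symm hr]
      · simp [hq, Ne.symm hr, Ne.symm hq]
    by_cases hq : q = 0
    · subst hq
      rw [(t3 p p).2.2] at hr
      simp [hp, Ne.symm hr]
    by_cases hpq' : p = q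
    · subst hpq'
      rw [(t3 p p).2.1 rfl] at hr
      simp [hp, hr]
    simp [hp, hq, hpq']

/-- The 3-design property. -/
theorem moment_eq (h : IsCliffordOrbit φ) (A B C : Op n) :
    (2 ^ n * (2 ^ n + 1) * (2 ^ n + 2)) * moment φ A B C =
      Fintype.card J * symTrace A B C := by
  have ext : ∀ B C : Op n,
      (∀ p, (2 ^ n * (2 ^ n + 1) * (2 ^ n + 2)) * moment φ (pauliString p) B C =
        Fintype.card J * symTrace (pauliString p) B C) →
      ∀ A, (2 ^ n * (2 ^ n + 1) * (2 ^ n + 2)) * moment φ A B C =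
        Fintype.card J * symTrace A B C := by
    intro B C hp A
    obtain ⟨a, rfl⟩ := exists_eq_sum_pauliString A
    have h1 : moment φ (∑ p, a p • pauliString p) B C =
        ∑ p, a p * moment φ (pauliString p) B C := by
      simp only [moment, Matrix.trace_sum, Matrix.mul_smul, Matrix.trace_smul,
        smul_eq_mul, Finset.sum_mul, Finset.mul_sum]
      rw [Finset.sum_comm]
      exact Finset.sum_congr rfl fun _ _ => Finset.sum_congr rfl fun _ _ => by ring
    have h2 : symTrace (∑ p, a p • pauliString p) B C =
        ∑ p, a p * symTrace (pauliString p) B C := by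
      simp only [symTrace, Matrix.trace_sum, Matrix.smul_mul, Matrix.trace_smul,
        smul_eq_mul, Finset.sum_mul, Finset.mul_sum, ← Finset.sum_add_distrib]
      exact Finset.sum_congr rfl fun _ _ => by ring
    rw [h1, h2, Finset.mul_sum, Finset.mul_sum]
    refine Finset.sum_congr rfl fun p _ => ?_
    linear_combination a p * hp p
  refine ext B C (fun p => ?_) A
  rw [moment_rotate, symTrace_rotate]
  refine ext C _ (fun q => ?_) B
  rw [moment_rotate, symTrace_rotate]
  refine ext _ _ (fun r => ?_) C
  exact h.moment_pauliString r p q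

end IsCliffordOrbit

theorem CliffordInvariant.isCliffordOrbit {ι : Type*} {W : ι → Op n}
    (hU : ∀ u, W u ∈ Matrix.unitaryGroup (Bits n) ℂ) (hW : CliffordInvariant W) :
    IsCliffordOrbit fun j : ι × Bits n => state W j.1 j.2 where
  trace_eq_one j := trace_state (hU j.1) j.2
  rank_one j A := state_mul_mul_state W j.1 j.2 A
  invariant V hV := by
    obtain ⟨π, hπ⟩ := hW.exists_state hV
    exact ⟨π.prodCongr (Equiv.refl _), fun j => hπ j.1 j.2⟩

/-! ### Traces against positive operators -/

open scoped MatrixOrder in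
theorem posSemidef_exists_sq {σ : Op n} (hσ : σ.PosSemidef) :
    ∃ C : Op n, C.conjTranspose = C ∧ σ = C * C :=
  ⟨CFC.sqrt σ, (Matrix.nonneg_iff_posSemidef.1 (CFC.sqrt_nonneg σ)).1,
    (CFC.sqrt_mul_sqrt_self σ hσ.nonneg).symm⟩

theorem re_trace_mul_le_opNorm {σ : Op n} (hσ : σ.PosSemidef) (X : Op n) :
    (σ * X).trace.re ≤ opNorm X * σ.trace.re := by
  obtain ⟨C, hC, rfl⟩ := posSemidef_exists_sq hσ
  let v : Bits n → EuclideanSpace ℂ (Bits n) := fun i => WithLp.toLp 2 fun y => C y i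
  have hcol : ∀ i, (C * X * C) i i = inner ℂ (v i)
      (Matrix.toEuclideanCLM (n := Bits n) (𝕜 := ℂ) X (v i)) :=
    fun i => by
      rw [Matrix.toEuclideanCLM_toLp, EuclideanSpace.inner_toLp_toLp, Matrix.mul_assoc,
        dotProduct_comm, Matrix.mul_apply]
      refine Finset.sum_congr rfl fun x _ => ?_
      congr 1
      conv_lhs => rw [← hC]
      rfl
  have hsq : ∀ i, (C * C) i i = ((‖v i‖ ^ 2 : ℝ) : ℂ) := fun i => by
    rw [Complex.ofReal_pow]
    refine Eq.trans ?_ (inner_self_eq_norm_sq_to_K (𝕜 := ℂ) (v i))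
    rw [EuclideanSpace.inner_toLp_toLp, dotProduct_comm, Matrix.mul_apply]
    refine Finset.sum_congr rfl fun x _ => ?_
    congr 1
    conv_lhs => rw [← hC]
    rfl
  have h1 : (C * C * X).trace = (C * X * C).trace := by
    rw [Matrix.mul_assoc, Matrix.trace_mul_comm]
  rw [h1, Matrix.trace, Matrix.trace, Complex.re_sum, Complex.re_sum, Finset.mul_sum]
  refine Finset.sum_le_sum fun i _ => ?_
  rw [Matrix.diag_apply, Matrix.diag_apply, hcol, hsq, Complex.ofReal_re]
  calc (inner ℂ (v i) (Matrix.toEuclideanCLM (n := Bits n) (𝕜 := ℂ) X (v i))).re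
      ≤ ‖v i‖ * ‖Matrix.toEuclideanCLM (n := Bits n) (𝕜 := ℂ) X (v i)‖ :=
        re_inner_le_norm (𝕜 := ℂ) _ _
    _ ≤ ‖v i‖ * (opNorm X * ‖v i‖) := by
        gcongr
        exact ContinuousLinearMap.le_opNorm _ _
    _ = _ := by ring

theorem re_trace_mul_sq_nonneg {σ X : Op n} (hσ : σ.PosSemidef) (hX : X.IsHermitian) :
    0 ≤ (σ * (X * X)).trace.re := by
  have h := (hσ.mul_mul_conjTranspose_same X).trace_nonneg
  rw [hX.eq, Matrix.mul_assoc, Matrix.trace_mul_comm, Matrix.mul_assoc] at h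
  exact (Complex.le_def.1 h).1

theorem re_trace_mul_comm_real {σ X : Op n} (hσ : σ.IsHermitian) (hX : X.IsHermitian) :
    (σ * X).trace = ((σ * X).trace.re : ℂ) := by
  have h : star (σ * X).trace = (σ * X).trace := by
    rw [← Matrix.trace_conjTranspose, Matrix.conjTranspose_mul, hσ.eq, hX.eq,
      Matrix.trace_mul_comm]
  exact (Complex.conj_eq_iff_re.1 h).symm

theorem trace_ofReal {X : Op n} (hX : X.IsHermitian) : X.trace = (X.trace.re : ℂ) := by
  have := re_trace_mul_comm_real (Matrix.isHermitian_one (n := Bits n) (α := ℂ)) hX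
  rwa [Matrix.one_mul] at this

theorem opNorm_mul_le (A B : Op n) : opNorm (A * B) ≤ opNorm A * opNorm B := by
  rw [opNorm, map_mul]
  exact norm_mul_le _ _

theorem posSemidef_maximallyMixed : (((2 : ℂ) ^ n)⁻¹ • (1 : Op n)).PosSemidef := by
  refine Matrix.PosSemidef.one.smul ?_
  have : (0 : ℝ) ≤ (2 ^ n)⁻¹ := by positivity
  have := Complex.zero_le_real.2 this
  push_cast at this
  exact this

theorem card_bits : Fintype.card (Bits n) = 2 ^ n := by simp

theorem trace_maximallyMixed : (((2 : ℂ) ^ n)⁻¹ • (1 : Op n)).trace = 1 := by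
  rw [Matrix.trace_smul, Matrix.trace_one, card_bits]
  push_cast
  exact inv_mul_cancel₀ (pow_ne_zero n two_ne_zero)

theorem op_ext_trace {X Y : Op n} (h : ∀ C, (X * C).trace = (Y * C).trace) : X = Y := by
  ext x y
  have := h (Matrix.single y x 1)
  rwa [Matrix.trace_mul_comm, trace_single_mul, Matrix.trace_mul_comm, trace_single_mul] at this

/-! ### Shadow frames -/

/-- The states `W_u |b⟩⟨b| W_u†` of a finite family of unitaries, with uniformly random `u` and all
`b`, resolve every operator `A` from a preimage `B` under the measurement map
`B ↦ 𝔼_u ∑_b Tr(φ B) φ`. For Hermitian `A` the preimage is Hermitian, and `g A` bounds the second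
moment of `Tr(φ B)` when the outcome `b` is that of a measurement of an arbitrary state `σ`. -/
structure IsShadowFrame {ι : Type*} [Fintype ι] (W : ι → Op n) (g : Op n → ℝ) : Prop where
  unitary : ∀ u, W u ∈ Matrix.unitaryGroup (Bits n) ℂ
  exists_preimage : ∀ A : Op n, ∃ B : Op n,
    (Fintype.card ι : ℂ)⁻¹ • ∑ j : ι × Bits n,
      (state W j.1 j.2 * B).trace • state W j.1 j.2 = A ∧
    (A.IsHermitian → B.IsHermitian ∧ ∀ σ : Op n, σ.PosSemidef → σ.trace = 1 →
      (Fintype.card ι : ℝ)⁻¹ * ∑ j : ι × Bits n,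
        (state W j.1 j.2 * σ).trace.re * (state W j.1 j.2 * B).trace.re ^ 2 ≤ g A)

/-! ### Global Clifford ensembles -/

/-- The 2-design identity, i.e. the 3-design identity with the identity operator as third argument;
it makes `B ↦ (Tr(B) + B) / (2 ^ n + 1)` the measurement map of a global Clifford ensemble. -/
theorem IsCliffordOrbit.sum_trace_smul {J : Type*} [Fintype J] {φ : J → Op n}
    (h : IsCliffordOrbit φ) (B : Op n) :
    ((2 : ℂ) ^ n * (2 ^ n + 1)) • ∑ j, (φ j * B).trace • φ j =
      (Fintype.card J : ℂ) • (B.trace • (1 : Op n) + B) := by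
  refine op_ext_trace fun C => ?_
  have h1 := h.moment_eq B C 1
  have h2 : ((∑ j, (φ j * B).trace • φ j) * C).trace = moment φ B C 1 := by
    rw [Matrix.sum_mul, Matrix.trace_sum]
    refine Finset.sum_congr rfl fun j _ => ?_
    rw [Matrix.smul_mul, Matrix.trace_smul, smul_eq_mul, Matrix.mul_one, h.trace_eq_one, mul_one]
  have h3 : symTrace B C 1 = (2 ^ n + 2) * (B.trace * C.trace + (B * C).trace) := by
    simp only [symTrace, Matrix.mul_one, Matrix.trace_one, card_bits]
    push_cast
    ring
  have hd : (2 ^ n + 2 : ℂ) ≠ 0 := by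
    have : (0 : ℝ) < 2 ^ n + 2 := by positivity
    exact_mod_cast this.ne'
  rw [Matrix.smul_mul, Matrix.trace_smul, h2, Matrix.smul_mul, Matrix.trace_smul, Matrix.add_mul,
    Matrix.trace_add, Matrix.smul_mul, Matrix.trace_smul, Matrix.one_mul]
  simp only [smul_eq_mul]
  refine mul_left_cancel₀ hd ?_
  rw [h3] at h1
  linear_combination h1

/-- The comparison of the exact second moment of a 3-design with `S A`: up to a positive factor, the
difference is `(d + 3) Tr(A²) + (2 d + 5) (Tr(A) + A)² + (2 d + 4) Tr(A)² + A²`. -/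
theorem symTrace_preimage_le {A σ : Op n} (hA : A.IsHermitian) (hσ : σ.PosSemidef)
    (hσ1 : σ.trace = 1) :
    (symTrace σ (((2 : ℂ) ^ n + 1) • A - A.trace • 1) (((2 : ℂ) ^ n + 1) • A - A.trace • 1)).re ≤
      (2 ^ n + 1) * (2 ^ n + 2) * opNorm (S A) := by
  have hS := re_trace_mul_le_opNorm hσ (S A)
  rw [hσ1, Complex.one_re, mul_one] at hS
  refine le_trans ?_ (mul_le_mul_of_nonneg_left hS (by positivity))
  have hAA : (A * A).IsHermitian := by
    rw [Matrix.IsHermitian, Matrix.conjTranspose_mul, hA.eq]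
  have ht := trace_ofReal hA
  have hs := trace_ofReal hAA
  have ha1 := re_trace_mul_comm_real hσ.1 hA
  have ha2 := re_trace_mul_comm_real hσ.1 hAA
  have hsq := re_trace_mul_sq_nonneg hσ hA
  have hs0 : 0 ≤ (A * A).trace.re := by
    have := re_trace_mul_sq_nonneg (Matrix.PosSemidef.one (n := Bits n) (R := ℂ)) hA
    rwa [Matrix.one_mul] at this
  have hsh := re_trace_mul_sq_nonneg hσ (X := A.trace • 1 + A) (by
    rw [Matrix.IsHermitian, Matrix.conjTranspose_add, Matrix.conjTranspose_smul, hA.eq,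
      Matrix.conjTranspose_one, ht, Complex.star_def, Complex.conj_ofReal])
  have hsh' : (σ * ((A.trace • 1 + A) * (A.trace • 1 + A))).trace =
      A.trace ^ 2 + 2 * A.trace * (σ * A).trace + (σ * (A * A)).trace := by
    simp only [Matrix.mul_add, Matrix.add_mul, Matrix.smul_mul, Matrix.mul_smul, Matrix.one_mul,
      Matrix.mul_one, Matrix.trace_add, Matrix.trace_smul, smul_eq_mul, hσ1]
    ring
  rw [hsh'] at hsh
  have hd : (Fintype.card (Bits n) : ℂ) = 2 ^ n := by rw [card_bits]; push_cast; rfl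
  have hL : symTrace σ (((2 : ℂ) ^ n + 1) • A - A.trace • 1)
        (((2 : ℂ) ^ n + 1) • A - A.trace • 1) =
      (2 ^ n + 1) * (((2 ^ n + 1) * (A * A).trace - A.trace ^ 2) - 2 * A.trace * (σ * A).trace +
        2 * (2 ^ n + 1) * (σ * (A * A)).trace) := by
    simp only [symTrace, Matrix.mul_sub, Matrix.sub_mul, Matrix.smul_mul, Matrix.mul_smul,
      Matrix.one_mul, Matrix.mul_one, Matrix.trace_sub, Matrix.trace_smul, smul_eq_mul, hσ1,
      Matrix.trace_one, hd, Matrix.mul_assoc]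
    ring
  have hR : (σ * S A).trace = 2 * (2 * A.trace ^ 2 + (A * A).trace +
      2 * A.trace * (σ * A).trace + 2 * (σ * (A * A)).trace) := by
    simp only [S, pow_two A, Matrix.mul_add, Matrix.mul_smul, Matrix.mul_one, Matrix.trace_add,
      Matrix.trace_smul, smul_eq_mul, hσ1]
    ring
  rw [hL, hR]
  generalize A.trace.re = t at ht
  generalize (A * A).trace.re = s at hs hs0
  generalize (σ * A).trace.re = a at ha1
  generalize (σ * (A * A)).trace.re = b at ha2 hsq
  rw [ht, hs, ha1, ha2]
  rw [ht, ha1, ha2] at hsh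
  have hd0 : (0 : ℝ) < 2 ^ n := by positivity
  generalize hD : (2 : ℝ) ^ n = D at hd0
  have hDc : (2 : ℂ) ^ n = (D : ℂ) := by rw [← hD]; push_cast; rfl
  rw [hDc]
  norm_cast
  norm_cast at hsh
  rw [mul_assoc (D + 1)]
  have hh : (0:ℝ) ≤ D + 1 := by positivity
  refine mul_le_mul_of_nonneg_left ?_ hh
  nlinarith [mul_nonneg hd0.le hs0, mul_nonneg hd0.le hsh, mul_nonneg hd0.le (sq_nonneg t),
    sq_nonneg t]

/-- The preimage of `A` is `(2 ^ n + 1) A - Tr(A)`; its second moment is a third moment of the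
design. -/
theorem isShadowFrame_of_cliffordInvariant {ι : Type*} [Fintype ι] [Nonempty ι] {W : ι → Op n}
    (hU : ∀ u, W u ∈ Matrix.unitaryGroup (Bits n) ℂ) (hW : CliffordInvariant W) :
    IsShadowFrame W fun A => opNorm (S A) := by
  have horb := hW.isCliffordOrbit hU
  have hι : (Fintype.card ι : ℂ) ≠ 0 := Nat.cast_ne_zero.2 Fintype.card_ne_zero
  have hcard : (Fintype.card (ι × Bits n) : ℂ) = Fintype.card ι * 2 ^ n := by
    rw [Fintype.card_prod, card_bits]
    push_cast
    rfl
  have hd : (2 ^ n : ℂ) ≠ 0 := pow_ne_zero n two_ne_zero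
  have hd1 : (2 ^ n + 1 : ℂ) ≠ 0 := by
    have : (0 : ℝ) < 2 ^ n + 1 := by positivity
    exact_mod_cast this.ne'
  refine ⟨hU, fun A => ⟨((2 : ℂ) ^ n + 1) • A - A.trace • 1, ?_, fun hA => ?_⟩⟩
  · have h1 := horb.sum_trace_smul (((2 : ℂ) ^ n + 1) • A - A.trace • 1)
    have h2 : (((2 : ℂ) ^ n + 1) • A - A.trace • (1 : Op n)).trace • (1 : Op n) +
        (((2 : ℂ) ^ n + 1) • A - A.trace • 1) = ((2 : ℂ) ^ n + 1) • A := by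
      rw [Matrix.trace_sub, Matrix.trace_smul, Matrix.trace_smul, Matrix.trace_one, card_bits]
      simp only [smul_eq_mul]
      push_cast
      module
    rw [h2, hcard, smul_smul] at h1
    have h3 := congrArg (fun X => ((Fintype.card ι : ℂ) * (2 ^ n * (2 ^ n + 1)))⁻¹ • X) h1
    simp only [smul_smul] at h3
    convert h3 using 1
    · congr 1
      field_simp
    · rw [show ((Fintype.card ι : ℂ) * (2 ^ n * (2 ^ n + 1)))⁻¹ *
        (Fintype.card ι * 2 ^ n * (2 ^ n + 1)) = 1 by field_simp, one_smul]
  · have hB : (((2 : ℂ) ^ n + 1) • A - A.trace • (1 : Op n)).IsHermitian := by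
      rw [Matrix.IsHermitian, Matrix.conjTranspose_sub, Matrix.conjTranspose_smul,
        Matrix.conjTranspose_smul, Matrix.conjTranspose_one, hA.eq, trace_ofReal hA]
      simp
    refine ⟨hB, fun σ hσ hσ1 => ?_⟩
    have hle := symTrace_preimage_le hA hσ hσ1
    set B := ((2 : ℂ) ^ n + 1) • A - A.trace • (1 : Op n)
    have h1 := horb.moment_eq σ B B
    have h2 : moment (fun j : ι × Bits n => state W j.1 j.2) σ B B =
        ((∑ j : ι × Bits n,
          (state W j.1 j.2 * σ).trace.re * (state W j.1 j.2 * B).trace.re ^ 2 : ℝ) : ℂ) := by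
      rw [moment]
      push_cast
      refine Finset.sum_congr rfl fun j _ => ?_
      rw [re_trace_mul_comm_real (state_posSemidef W j.1 j.2).1 hσ.1,
        re_trace_mul_comm_real (state_posSemidef W j.1 j.2).1 hB, Complex.ofReal_re,
        Complex.ofReal_re]
      ring
    rw [h2, hcard] at h1
    generalize (∑ j : ι × Bits n,
          (state W j.1 j.2 * σ).trace.re * (state W j.1 j.2 * B).trace.re ^ 2 : ℝ) = x at h1
    have h3 : (2 ^ n * (2 ^ n + 1) * (2 ^ n + 2)) * x =
        Fintype.card ι * 2 ^ n * (symTrace σ B B).re := by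
      have hc : (((2 ^ n * (2 ^ n + 1) * (2 ^ n + 2)) * x : ℝ) : ℂ) =
          ((Fintype.card ι * 2 ^ n : ℝ) : ℂ) * symTrace σ B B := by
        push_cast
        exact h1
      have := congrArg Complex.re hc
      rwa [Complex.ofReal_re, Complex.re_ofReal_mul] at this
    have hι' : (0 : ℝ) < Fintype.card ι := by exact_mod_cast Fintype.card_pos
    have hd0 : (0 : ℝ) < 2 ^ n := by positivity
    rw [inv_mul_le_iff₀ hι']
    have h4 : (2 ^ n * (2 ^ n + 1) * (2 ^ n + 2)) * x ≤
        (2 ^ n * (2 ^ n + 1) * (2 ^ n + 2)) * (Fintype.card ι * opNorm (S A)) := by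
      rw [h3]
      calc _ ≤ Fintype.card ι * 2 ^ n * ((2 ^ n + 1) * (2 ^ n + 2) * opNorm (S A)) := by gcongr
        _ = _ := by ring
    exact le_of_mul_le_mul_left h4 (by positivity)

instance : Nonempty (CliffordClass n) :=
  ⟨CliffordClass.mk _ (isClifford_pauliString 0)⟩

theorem isShadowFrame_rep :
    IsShadowFrame (CliffordClass.rep : CliffordClass n → Op n) fun A => opNorm (S A) :=
  isShadowFrame_of_cliffordInvariant (fun u => u.isClifford_rep.1) cliffordInvariant_rep

theorem isShadowFrame_conjTranspose_rep :
    IsShadowFrame (fun c : CliffordClass n => c.rep.conjTranspose) fun A => opNorm (S A) :=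
  isShadowFrame_of_cliffordInvariant (fun u => u.isClifford_rep.conjTranspose.1)
    cliffordInvariant_conjTranspose_rep

/-! ### Products of single-qubit Clifford ensembles -/

/-- A single-qubit matrix as an operator on a register of one qubit. -/
def lift (a : Matrix (Fin 2) (Fin 2) ℂ) : Op 1 := tensor fun _ => a

/-- The `2 × 2` matrix of an operator on a register of one qubit. -/
def qubitMatrix (A : Op 1) : Matrix (Fin 2) (Fin 2) ℂ :=
  Matrix.of fun a b => A (fun _ => a) (fun _ => b)

theorem lift_qubitMatrix (A : Op 1) : lift (qubitMatrix A) = A := by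
  ext x y
  have h : ∀ x : Bits 1, (fun _ => x 0) = x := fun x => by
    funext i
    rw [Subsingleton.elim i 0]
  simp [lift, tensor, qubitMatrix, h]

theorem qubitMatrix_lift (a : Matrix (Fin 2) (Fin 2) ℂ) : qubitMatrix (lift a) = a := by
  ext x y
  simp [lift, tensor, qubitMatrix]

theorem lift_mul (a b : Matrix (Fin 2) (Fin 2) ℂ) : lift (a * b) = lift a * lift b :=
  (tensor_mul _ _).symm

theorem lift_one : lift 1 = 1 := tensor_one

theorem lift_conjTranspose (a : Matrix (Fin 2) (Fin 2) ℂ) :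
    lift a.conjTranspose = (lift a).conjTranspose := (conjTranspose_tensor _).symm

theorem trace_lift (a : Matrix (Fin 2) (Fin 2) ℂ) : (lift a).trace = a.trace := by
  rw [lift, trace_tensor, Fin.prod_univ_one]

theorem lift_pauli (a : Fin 4) : lift (pauli a) = pauliString fun _ => a := rfl

theorem lift_single (β : Fin 2) :
    lift (Matrix.single β β 1) = Matrix.single (fun _ => β) (fun _ => β) 1 :=
  (single_eq_tensor _ _).symm

/-- The products `⨂ᵢ W (c i)` of `n` independently chosen members of a single-qubit family. -/
def localFamily {ι : Type*} (W : ι → Op 1) (c : Fin n → ι) : Op n :=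
  tensor fun i => qubitMatrix (W (c i))

/-- The single-qubit states of a family, as `2 × 2` matrices. -/
def qubitState {ι : Type*} (W : ι → Op 1) (j : ι × Fin 2) : Matrix (Fin 2) (Fin 2) ℂ :=
  qubitMatrix (W j.1) * Matrix.single j.2 j.2 1 * (qubitMatrix (W j.1)).conjTranspose

theorem state_localFamily {ι : Type*} (W : ι → Op 1) (c : Fin n → ι) (b : Bits n) :
    state (localFamily W) c b = tensor fun i => qubitState W (c i, b i) := by
  rw [state, localFamily, single_eq_tensor, conjTranspose_tensor, tensor_mul, tensor_mul]
  rfl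

theorem lift_qubitState {ι : Type*} (W : ι → Op 1) (j : ι × Fin 2) :
    lift (qubitState W j) = state W j.1 fun _ => j.2 := by
  rw [qubitState, lift_mul, lift_mul, lift_conjTranspose, lift_qubitMatrix, lift_single, state]

theorem trace_qubitState_mul {ι : Type*} (W : ι → Op 1) (j : ι × Fin 2)
    (a : Matrix (Fin 2) (Fin 2) ℂ) :
    (qubitState W j * a).trace = (state W j.1 (fun _ => j.2) * lift a).trace := by
  rw [← lift_qubitState, ← lift_mul, trace_lift]

theorem localFamily_mem_unitaryGroup {ι : Type*} {W : ι → Op 1}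
    (hW : ∀ u, W u ∈ Matrix.unitaryGroup (Bits 1) ℂ) (c : Fin n → ι) :
    localFamily W c ∈ Matrix.unitaryGroup (Bits n) ℂ := by
  have h : ∀ u, qubitMatrix (W u) * (qubitMatrix (W u)).conjTranspose = 1 := fun u => by
    rw [← qubitMatrix_lift (qubitMatrix (W u) * _), lift_mul, lift_conjTranspose,
      lift_qubitMatrix, ← Matrix.star_eq_conjTranspose, Matrix.mem_unitaryGroup_iff.1 (hW u),
      ← lift_one, qubitMatrix_lift]
  rw [Matrix.mem_unitaryGroup_iff, Matrix.star_eq_conjTranspose, localFamily,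
    conjTranspose_tensor, tensor_mul]
  simp only [h, tensor_one]

theorem trace_state_localFamily_mul_tensor {ι : Type*} (W : ι → Op 1) (c : Fin n → ι)
    (b : Bits n) (a : Fin n → Matrix (Fin 2) (Fin 2) ℂ) :
    (state (localFamily W) c b * tensor a).trace =
      ∏ i, (qubitState W (c i, b i) * a i).trace := by
  rw [state_localFamily, tensor_mul, trace_tensor]

theorem sum_prod_localFamily {ι : Type*} [Fintype ι] (F : Fin n → ι × Fin 2 → ℂ) :
    ∑ j : (Fin n → ι) × Bits n, ∏ i, F i (j.1 i, j.2 i) = ∏ i, ∑ j, F i j := by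
  rw [Finset.prod_univ_sum, Fintype.piFinset_univ]
  exact (Equiv.sum_comp (Equiv.arrowProdEquivProdArrow (Fin n) (fun _ => ι) (fun _ => Fin 2))
    (fun j : (Fin n → ι) × Bits n => ∏ i, F i (j.1 i, j.2 i))).symm

/-- The eigenvalue of the single-qubit measurement map on a Pauli matrix. -/
def qubitEig (a : Fin 4) : ℝ := if a = 0 then 1 else 1 / 3

/-- The eigenvalue of the measurement map of a local ensemble on a Pauli string. -/
def localEig (p : Fin n → Fin 4) : ℝ := ∏ i, qubitEig (p i)

theorem qubitEig_pos (a : Fin 4) : 0 < qubitEig a := by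
  rw [qubitEig]
  split_ifs <;> norm_num

theorem localEig_pos (p : Fin n → Fin 4) : 0 < localEig p :=
  Finset.prod_pos fun _ _ => qubitEig_pos _

section LocalFamily

variable {ι : Type*} [Fintype ι] {W : ι → Op 1} (hcl : ∀ u, IsClifford (W u))
  (hW : CliffordInvariant W)

include hcl hW

/-- The 3-design identity for one qubit, where `2 (2 + 1) (2 + 2) = 24` and each unitary contributes
two states. -/
theorem sum_qubitState (a b c : Matrix (Fin 2) (Fin 2) ℂ) :
    12 * ∑ j, (qubitState W j * a).trace * (qubitState W j * b).trace *
      (qubitState W j * c).trace =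
      Fintype.card ι * symTrace (lift a) (lift b) (lift c) := by
  have h1 := (hW.isCliffordOrbit fun u => (hcl u).1).moment_eq (lift a) (lift b) (lift c)
  have h2 : moment (fun j : ι × Bits 1 => state W j.1 j.2) (lift a) (lift b) (lift c) =
      ∑ j, (qubitState W j * a).trace * (qubitState W j * b).trace *
        (qubitState W j * c).trace := by
    rw [moment, ← Equiv.sum_comp ((Equiv.refl ι).prodCongr (Equiv.funUnique (Fin 1) (Fin 2)).symm)]
    simp only [trace_qubitState_mul]
    rfl
  rw [h2, Fintype.card_prod, card_bits] at h1
  push_cast at h1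
  linear_combination (1 / 2 : ℂ) * h1

theorem sum_qubitState_pauli (a : Fin 4) (c : Matrix (Fin 2) (Fin 2) ℂ) :
    ∑ j, (qubitState W j * pauli a).trace * (qubitState W j * c).trace =
      Fintype.card ι * (qubitEig a * (pauli a * c).trace) := by
  have h1 := sum_qubitState hcl hW (pauli a) c 1
  have h2 : ∀ j, (qubitState W j).trace = 1 := fun j => by
    rw [← Matrix.mul_one (qubitState W j), trace_qubitState_mul, lift_one, Matrix.mul_one,
      trace_state (hcl _).1]
  rw [symTrace, lift_one] at h1
  simp only [h2, mul_one] at h1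
  rw [Matrix.trace_one, ← lift_mul, trace_lift, trace_lift, trace_lift, pauli_trace,
    card_bits] at h1
  rw [qubitEig]
  split_ifs with ha
  · subst ha
    rw [if_pos rfl, pauli_zero, Matrix.one_mul] at h1
    rw [pauli_zero, Matrix.one_mul]
    push_cast at h1 ⊢
    linear_combination (1 / 12 : ℂ) * h1
  · rw [if_neg ha] at h1
    push_cast at h1 ⊢
    linear_combination (1 / 12 : ℂ) * h1

theorem sum_qubitState_pauli_sq (a : Fin 4) (c : Matrix (Fin 2) (Fin 2) ℂ) :
    ∑ j, (qubitState W j * pauli a).trace * (qubitState W j * pauli a).trace *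
      (qubitState W j * c).trace = Fintype.card ι * (qubitEig a * c.trace) := by
  have h1 := sum_qubitState hcl hW (pauli a) (pauli a) c
  have h3 : (lift (pauli a) * lift c * lift (pauli a)).trace = c.trace := by
    rw [Matrix.trace_mul_comm, ← Matrix.mul_assoc, ← lift_mul, pauli_mul_self, lift_one,
      Matrix.one_mul, trace_lift]
  rw [symTrace, h3, ← lift_mul, pauli_mul_self, lift_one, Matrix.one_mul, Matrix.trace_one,
    trace_lift, trace_lift, pauli_trace, card_bits] at h1
  rw [qubitEig]
  split_ifs with ha
  · subst ha
    rw [if_pos rfl, pauli_zero, lift_one, Matrix.one_mul, trace_lift] at h1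
    rw [pauli_zero]
    push_cast at h1 ⊢
    linear_combination (1 / 12 : ℂ) * h1
  · rw [if_neg ha] at h1
    push_cast at h1 ⊢
    linear_combination (1 / 12 : ℂ) * h1

/-- The measurement map of a local ensemble is diagonal in the Pauli basis. -/
theorem sum_localFamily_pauliString (p : Fin n → Fin 4) :
    ∑ j : (Fin n → ι) × Bits n, (state (localFamily W) j.1 j.2 * pauliString p).trace •
      state (localFamily W) j.1 j.2 =
      ((Fintype.card ι : ℂ) ^ n * localEig p) • pauliString p := by
  ext x y
  have h : ∀ A : Op n, A x y = (A * Matrix.single y x 1).trace := fun A => by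
    rw [Matrix.trace_mul_comm, trace_single_mul]
  rw [Matrix.sum_apply]
  simp only [Matrix.smul_apply, smul_eq_mul]
  simp only [h, single_eq_tensor, pauliString_eq_tensor, trace_state_localFamily_mul_tensor,
    ← Finset.prod_mul_distrib]
  rw [sum_prod_localFamily fun i j => (qubitState W j * pauli (p i)).trace *
    (qubitState W j * Matrix.single (y i) (x i) (1 : ℂ)).trace]
  simp only [sum_qubitState_pauli hcl hW, Finset.prod_mul_distrib, tensor_mul, trace_tensor,
    localEig, Finset.prod_const, Finset.card_univ, Fintype.card_fin, Complex.ofReal_prod, mul_assoc]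

/-- The second moment of a Pauli expectation does not depend on the measured state `C`, apart from
its trace. -/
theorem sum_localFamily_pauliString_sq (p : Fin n → Fin 4) (C : Op n) :
    ∑ j : (Fin n → ι) × Bits n, (state (localFamily W) j.1 j.2 * pauliString p).trace ^ 2 *
      (state (localFamily W) j.1 j.2 * C).trace =
      ((Fintype.card ι : ℂ) ^ n * localEig p) * C.trace := by
  have h : ∀ q : Fin n → Fin 4,
      ∑ j : (Fin n → ι) × Bits n, (state (localFamily W) j.1 j.2 * pauliString p).trace ^ 2 *
        (state (localFamily W) j.1 j.2 * pauliString q).trace =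
        ((Fintype.card ι : ℂ) ^ n * localEig p) * (pauliString q).trace := fun q => by
    simp only [pauliString_eq_tensor, trace_state_localFamily_mul_tensor, pow_two,
      ← Finset.prod_mul_distrib]
    rw [sum_prod_localFamily fun i j => (qubitState W j * pauli (p i)).trace *
      (qubitState W j * pauli (p i)).trace * (qubitState W j * pauli (q i)).trace]
    simp only [sum_qubitState_pauli_sq hcl hW, Finset.prod_mul_distrib, trace_tensor,
      localEig, Finset.prod_const, Finset.card_univ, Fintype.card_fin, Complex.ofReal_prod]
    ring
  obtain ⟨a, rfl⟩ := exists_eq_sum_pauliString C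
  simp only [Matrix.trace_sum, Matrix.mul_smul, Matrix.trace_smul, smul_eq_mul, Finset.mul_sum]
  rw [Finset.sum_comm]
  refine Finset.sum_congr rfl fun q _ => ?_
  rw [mul_left_comm, ← h q, Finset.mul_sum]
  exact Finset.sum_congr rfl fun _ _ => by ring

end LocalFamily

/-- The expectation of a Pauli matrix in a single-qubit stabilizer state is `0`, `1` or `-1`. -/
theorem trace_qubitState_pauli_cube {ι : Type*} {W : ι → Op 1} (hcl : ∀ u, IsClifford (W u))
    (j : ι × Fin 2) (a : Fin 4) :
    (qubitState W j * pauli a).trace ^ 3 = (qubitState W j * pauli a).trace := by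
  rw [trace_qubitState_mul, lift_pauli, trace_state_mul]
  obtain ⟨s, q, h⟩ := (hcl j.1).conjTranspose.2 fun _ => a
  rw [Matrix.conjTranspose_conjTranspose] at h
  rw [h]
  have key : ∀ (b : Fin 4) (β : Fin 2), pauli b β β ^ 3 = pauli b β β := fun b β => by
    fin_cases b <;> fin_cases β <;> norm_num [pauli]
  have h2 : (pauliString q : Op 1) (fun _ => j.2) (fun _ => j.2) = pauli (q 0) j.2 j.2 := by
    simp [pauliString]
  have h3 : (if s then (1 : ℂ) else -1) ^ 3 = if s then (1 : ℂ) else -1 := by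
    cases s <;> norm_num
  rw [Matrix.smul_apply, smul_eq_mul, h2, mul_pow, key, h3]

theorem sum_trace_qubitState_pauli_sq {ι : Type*} {W : ι → Op 1} (hcl : ∀ u, IsClifford (W u))
    (j : ι × Fin 2) : ∑ a, (qubitState W j * pauli a).trace ^ 2 = 2 := by
  have h1 := sum_trace_mul_trace (state W j.1 fun _ => j.2) (state W j.1 fun _ => j.2)
  have h2 := state_mul_mul_state W j.1 (fun _ => j.2) 1
  rw [Matrix.mul_one, trace_state (hcl _).1, one_smul] at h2
  rw [h2, trace_state (hcl _).1, ← Equiv.sum_comp (Equiv.funUnique (Fin 1) (Fin 4)).symm] at h1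
  rw [pow_one, mul_one] at h1
  rw [← h1]
  refine Finset.sum_congr rfl fun a _ => ?_
  rw [trace_qubitState_mul, lift_pauli, Matrix.trace_mul_comm, pow_two]
  rfl

theorem trace_qubitState_pauli_zero {ι : Type*} {W : ι → Op 1} (hcl : ∀ u, IsClifford (W u))
    (j : ι × Fin 2) : (qubitState W j * pauli 0).trace = 1 := by
  rw [trace_qubitState_mul, pauli_zero, lift_one, Matrix.mul_one, trace_state (hcl _).1]

/-! ### The Pauli expansion of an operator that acts on few qubits -/

theorem pauliString_update {p : Fin n → Fin 4} {q : Fin n} (hp : p q ≠ 0) {x y : Bits n}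
    (hxy : x q = y q) :
    pauliString p (Function.update x q (x q + 1)) (Function.update y q (y q + 1)) =
      -pauliString p x y := by
  have key : ∀ (a : Fin 4) (β : Fin 2), a ≠ 0 → pauli a (β + 1) (β + 1) = -pauli a β β := by
    intro a β ha
    fin_cases a
    · exact absurd rfl ha
    all_goals fin_cases β <;> simp [pauli]
  simp only [pauliString, Matrix.of_apply]
  rw [← Finset.mul_prod_erase _ _ (Finset.mem_univ q),
    ← Finset.mul_prod_erase _ (fun i => pauli (p i) (x i) (y i)) (Finset.mem_univ q),
    Function.update_self, Function.update_self, ← hxy, key _ _ hp, neg_mul]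
  congr 2
  refine Finset.prod_congr rfl fun i hi => ?_
  rw [Function.update_of_ne (Finset.ne_of_mem_erase hi),
    Function.update_of_ne (Finset.ne_of_mem_erase hi)]

/-- Only Pauli strings supported where `A` acts nontrivially occur in the Pauli expansion of `A`.
Flipping qubit `q` in both indices preserves the entries of `A`, which vanish off the diagonal of
qubit `q`, and reverses the sign of the diagonal entries of `pauli (p q)`. -/
theorem trace_pauliString_mul_eq_zero {A : Op n} {q : Fin n} (hA : ActsTriviallyOn A q)
    {p : Fin n → Fin 4} (hp : p q ≠ 0) : (pauliString p * A).trace = 0 := by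
  have hinv : Function.Involutive fun x : Bits n => Function.update x q (x q + 1) := fun x => by
    have : ∀ β : Fin 2, β + 1 + 1 = β := by decide
    simp [this]
  let e : Equiv.Perm (Bits n) := hinv.toPerm
  have h : ∀ x y, pauliString p (e x) (e y) * A (e y) (e x) = -(pauliString p x y * A y x) :=
    fun x y => by
      by_cases hxy : x q = y q
      · have h1 : A (e y) (e x) = A y x := by
          have := (hA y x).2 hxy.symm (y q + 1)
          rw [← this]
          simp only [e, Function.Involutive.coe_toPerm, hxy]
        have h2 : pauliString p (e x) (e y) = -pauliString p x y := pauliString_update hp hxy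
        rw [h1, h2, neg_mul]
      · have h1 : A y x = 0 := (hA y x).1 (Ne.symm hxy)
        have h2 : A (e y) (e x) = 0 := (hA _ _).1 (by
          simp only [e, Function.Involutive.coe_toPerm, Function.update_self]
          exact fun h => hxy (add_right_cancel h).symm)
        rw [h1, h2, mul_zero, mul_zero, neg_zero]
  have hsum : ∑ x, ∑ y, pauliString p x y * A y x = -∑ x, ∑ y, pauliString p x y * A y x := by
    conv_lhs => rw [← Equiv.sum_comp e]
    simp_rw [← Finset.sum_neg_distrib]
    refine Finset.sum_congr rfl fun x _ => ?_
    conv_lhs => rw [← Equiv.sum_comp e]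
    exact Finset.sum_congr rfl fun y _ => h x y
  have ht : (pauliString p * A).trace = ∑ x, ∑ y, pauliString p x y * A y x := by
    simp [Matrix.trace, Matrix.mul_apply]
  rw [ht]
  linear_combination (1 / 2 : ℂ) * hsum

/-! ### Local Clifford ensembles -/

theorem isHermitian_pauliString (p : Fin n → Fin 4) : (pauliString p).IsHermitian :=
  pauliString_conjTranspose p

/-- For a product of single-qubit stabilizer states, the squared Pauli expectations on `k` qubits,
weighted by `3 ^ |p|`, add up to `4 ^ k`: on each qubit only one Pauli axis contributes. -/
theorem sum_sq_expectation {ι : Type*} {W : ι → Op 1} (hcl : ∀ u, IsClifford (W u))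
    (c : Fin n → ι) (b : Bits n) (T : Finset (Fin n)) :
    ∑ p ∈ Fintype.piFinset (fun i => if i ∈ T then (Finset.univ : Finset (Fin 4)) else {0}),
      (localEig p)⁻¹ * (state (localFamily W) c b * pauliString p).trace.re ^ 2 = 4 ^ T.card := by
  have h0 : ∑ p ∈ Fintype.piFinset (fun i => if i ∈ T then (Finset.univ : Finset (Fin 4)) else {0}),
      ((localEig p : ℂ))⁻¹ * (state (localFamily W) c b * pauliString p).trace ^ 2 =
      4 ^ T.card := by
    have h1 : ∀ p : Fin n → Fin 4,
        ((localEig p : ℂ))⁻¹ * (state (localFamily W) c b * pauliString p).trace ^ 2 =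
        ∏ i, ((qubitEig (p i) : ℂ)⁻¹ * (qubitState W (c i, b i) * pauli (p i)).trace ^ 2) :=
      fun p => by
        rw [pauliString_eq_tensor, trace_state_localFamily_mul_tensor, localEig,
          Complex.ofReal_prod, Finset.prod_mul_distrib, Finset.prod_inv_distrib, Finset.prod_pow]
    simp only [h1]
    rw [← Finset.prod_univ_sum (fun i => if i ∈ T then (Finset.univ : Finset (Fin 4)) else {0})
      (fun i a => (qubitEig a : ℂ)⁻¹ * (qubitState W (c i, b i) * pauli a).trace ^ 2)]
    have h2 : ∀ i, ∑ a ∈ (if i ∈ T then (Finset.univ : Finset (Fin 4)) else {0}),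
        (qubitEig a : ℂ)⁻¹ * (qubitState W (c i, b i) * pauli a).trace ^ 2 =
        if i ∈ T then 4 else 1 := fun i => by
      have hz := trace_qubitState_pauli_zero hcl (c i, b i)
      have hs := sum_trace_qubitState_pauli_sq hcl (c i, b i)
      split_ifs
      · rw [Fin.sum_univ_four, hz] at hs
        rw [Fin.sum_univ_four, hz]
        simp only [qubitEig, if_pos, show ¬ (1 : Fin 4) = 0 by decide,
          show ¬ (2 : Fin 4) = 0 by decide, show ¬ (3 : Fin 4) = 0 by decide, if_false]
        push_cast
        linear_combination 3 * hs
      · rw [Finset.sum_singleton, hz, qubitEig, if_pos rfl]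
        simp
    simp only [h2]
    rw [Finset.prod_ite, Finset.prod_const, Finset.prod_const_one, mul_one]
    simp
  have h3 := congrArg Complex.re h0
  have h4 : ∀ p, (state (localFamily W) c b * pauliString p).trace =
      ((state (localFamily W) c b * pauliString p).trace.re : ℂ) := fun p =>
    re_trace_mul_comm_real (state_posSemidef _ _ _).1 (isHermitian_pauliString p)
  have h5 : ∀ p : Fin n → Fin 4,
      ((localEig p : ℂ))⁻¹ * (state (localFamily W) c b * pauliString p).trace ^ 2 =
      (((localEig p)⁻¹ * (state (localFamily W) c b * pauliString p).trace.re ^ 2 : ℝ) : ℂ) :=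
    fun p => by
      conv_lhs => rw [h4]
      push_cast
      rfl
  simp only [h5, ← Complex.ofReal_sum, Complex.ofReal_re] at h3
  rw [h3]
  have : (4 : ℂ) ^ T.card = ((4 ^ T.card : ℝ) : ℂ) := by push_cast; rfl
  rw [this, Complex.ofReal_re]

/-- The expectation of a Pauli string in a product of stabilizer states is `0`, `1` or `-1`. -/
theorem expectation_cube {ι : Type*} {W : ι → Op 1} (hcl : ∀ u, IsClifford (W u))
    (c : Fin n → ι) (b : Bits n) (p : Fin n → Fin 4) :
    (state (localFamily W) c b * pauliString p).trace.re ^ 3 =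
      (state (localFamily W) c b * pauliString p).trace.re := by
  have h : (state (localFamily W) c b * pauliString p).trace ^ 3 =
      (state (localFamily W) c b * pauliString p).trace := by
    rw [pauliString_eq_tensor, trace_state_localFamily_mul_tensor, ← Finset.prod_pow]
    simp only [trace_qubitState_pauli_cube hcl]
  rw [re_trace_mul_comm_real (state_posSemidef _ _ _).1 (isHermitian_pauliString p)] at h
  exact_mod_cast h

/-- The preimage of `A` is obtained by dividing its Pauli coefficients by the eigenvalues. If `A`
acts on `k` qubits, the Cauchy–Schwarz inequality splits off the factor `4 ^ k`, and the
eigenvalues cancel in what remains, the sum of the squared Pauli coefficients of `A`. -/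
theorem isShadowFrame_localFamily {ι : Type*} [Fintype ι] [Nonempty ι] {W : ι → Op 1}
    (hcl : ∀ u, IsClifford (W u)) (hW : CliffordInvariant W) :
    IsShadowFrame (localFamily W : (Fin n → ι) → Op n)
      fun A => 4 ^ suppSize A * opNorm A ^ 2 := by
  classical
  have hι : (Fintype.card ι : ℂ) ≠ 0 := Nat.cast_ne_zero.2 Fintype.card_ne_zero
  have hι' : (0 : ℝ) < Fintype.card ι := Nat.cast_pos.2 Fintype.card_pos
  have hd : (2 ^ n : ℂ) ≠ 0 := pow_ne_zero n two_ne_zero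
  have hcard : Fintype.card (Fin n → ι) = Fintype.card ι ^ n := by simp
  refine ⟨localFamily_mem_unitaryGroup fun u => (hcl u).1, fun A =>
    ⟨∑ p, ((localEig p : ℂ)⁻¹ * (((2 : ℂ) ^ n)⁻¹ * (pauliString p * A).trace)) • pauliString p,
      ?_, fun hA => ?_⟩⟩
  · have h1 : ∑ j : (Fin n → ι) × Bits n, (state (localFamily W) j.1 j.2 *
        ∑ p, ((localEig p : ℂ)⁻¹ * (((2 : ℂ) ^ n)⁻¹ * (pauliString p * A).trace)) •
          pauliString p).trace • state (localFamily W) j.1 j.2 =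
        (Fintype.card ι : ℂ) ^ n • A := by
      have h2 : ∀ j : (Fin n → ι) × Bits n, (state (localFamily W) j.1 j.2 *
        ∑ p, ((localEig p : ℂ)⁻¹ * (((2 : ℂ) ^ n)⁻¹ * (pauliString p * A).trace)) •
          pauliString p).trace • state (localFamily W) j.1 j.2 =
          ∑ p, ((localEig p : ℂ)⁻¹ * (((2 : ℂ) ^ n)⁻¹ * (pauliString p * A).trace)) •
            ((state (localFamily W) j.1 j.2 * pauliString p).trace •
              state (localFamily W) j.1 j.2) := fun j => by
        rw [Matrix.mul_sum, Matrix.trace_sum, Finset.sum_smul]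
        refine Finset.sum_congr rfl fun p _ => ?_
        rw [Matrix.mul_smul, Matrix.trace_smul, smul_eq_mul, smul_smul]
      simp only [h2]
      rw [Finset.sum_comm]
      have h3 : ∀ p : Fin n → Fin 4, ∑ j : (Fin n → ι) × Bits n,
          ((localEig p : ℂ)⁻¹ * (((2 : ℂ) ^ n)⁻¹ * (pauliString p * A).trace)) •
            ((state (localFamily W) j.1 j.2 * pauliString p).trace •
              state (localFamily W) j.1 j.2) =
          ((Fintype.card ι : ℂ) ^ n * (2 ^ n)⁻¹) •
            ((pauliString p * A).trace • pauliString p) := fun p => by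
        have : (localEig p : ℂ) ≠ 0 := Complex.ofReal_ne_zero.2 (localEig_pos p).ne'
        rw [← Finset.smul_sum, sum_localFamily_pauliString hcl hW, smul_smul, smul_smul]
        congr 1
        field_simp
      simp only [h3]
      rw [← Finset.smul_sum, sum_trace_smul_pauliString, smul_smul, mul_assoc,
        inv_mul_cancel₀ hd, mul_one]
    rw [h1, hcard, smul_smul]
    push_cast
    rw [inv_mul_cancel₀ (pow_ne_zero n hι), one_smul]
  · -- the real Pauli coefficients of `A`
    set α : (Fin n → Fin 4) → ℝ := fun p => (2 ^ n)⁻¹ * (pauliString p * A).trace.re with hα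
    have hαc : ∀ p, ((2 : ℂ) ^ n)⁻¹ * (pauliString p * A).trace = (α p : ℂ) := fun p => by
      rw [re_trace_mul_comm_real (isHermitian_pauliString p) hA, hα]
      push_cast
      rfl
    simp only [hαc]
    set B := ∑ p, ((localEig p : ℂ)⁻¹ * (α p : ℂ)) • pauliString p with hBdef
    have hB : B.IsHermitian := by
      rw [Matrix.IsHermitian, hBdef, Matrix.conjTranspose_sum]
      refine Finset.sum_congr rfl fun p _ => ?_
      rw [Matrix.conjTranspose_smul, pauliString_conjTranspose]
      simp
    refine ⟨hB, fun σ hσ hσ1 => ?_⟩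
    set T : Finset (Fin n) := Finset.univ.filter fun q => ¬ ActsTriviallyOn A q with hT
    have hTcard : suppSize A = T.card := by
      rw [suppSize, Set.ncard_eq_toFinset_card', hT]
      congr 1
      ext q
      simp
    set PT := Fintype.piFinset fun i => if i ∈ T then (Finset.univ : Finset (Fin 4)) else {0}
      with hPT
    have hα0 : ∀ p, p ∉ PT → α p = 0 := fun p hp => by
      rw [hPT, Fintype.mem_piFinset] at hp
      push Not at hp
      obtain ⟨q, hq⟩ := hp
      have hqT : q ∉ T := fun h => by simp [h] at hq
      rw [if_neg hqT, Finset.mem_singleton] at hq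
      have hq2 : ActsTriviallyOn A q := by simpa [hT] using hqT
      simp [hα, trace_pauliString_mul_eq_zero hq2 hq]
    set χ : (Fin n → ι) × Bits n → (Fin n → Fin 4) → ℝ := fun j p =>
      (state (localFamily W) j.1 j.2 * pauliString p).trace.re with hχ
    set w : (Fin n → ι) × Bits n → ℝ := fun j => (state (localFamily W) j.1 j.2 * σ).trace.re
      with hw
    have hw0 : ∀ j, 0 ≤ w j := fun j => by
      obtain ⟨C, hC, hC2⟩ := posSemidef_exists_sq hσ
      simp only [hw]
      rw [hC2]
      exact re_trace_mul_sq_nonneg (state_posSemidef _ _ _) hC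
    have hx : ∀ j : (Fin n → ι) × Bits n, (state (localFamily W) j.1 j.2 * B).trace.re =
        ∑ p ∈ PT, (localEig p)⁻¹ * α p * χ j p := fun j => by
      rw [hBdef, Matrix.mul_sum, Matrix.trace_sum, Complex.re_sum]
      symm
      refine Eq.trans (Finset.sum_subset (Finset.subset_univ PT) fun p _ hp => ?_)
        (Finset.sum_congr rfl fun p _ => ?_)
      · rw [hα0 p hp]
        simp
      · rw [Matrix.mul_smul, Matrix.trace_smul, smul_eq_mul, ← Complex.ofReal_inv,
          ← Complex.ofReal_mul, Complex.re_ofReal_mul]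
    have hCS : ∀ j, (state (localFamily W) j.1 j.2 * B).trace.re ^ 2 ≤
        4 ^ suppSize A * ∑ p, (localEig p)⁻¹ * α p ^ 2 * χ j p ^ 2 := fun j => by
      have hpos : ∀ p : Fin n → Fin 4, 0 ≤ (localEig p)⁻¹ := fun p =>
        (inv_pos.2 (localEig_pos p)).le
      rw [hx j, hTcard, ← sum_sq_expectation hcl j.1 j.2 T]
      refine (Finset.sum_sq_le_sum_mul_sum_of_sq_le_mul PT
        (f := fun p => (localEig p)⁻¹ * χ j p ^ 2)
        (g := fun p => (localEig p)⁻¹ * α p ^ 2 * χ j p ^ 2)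
        (fun p _ => mul_nonneg (hpos p) (sq_nonneg _))
        (fun p _ => mul_nonneg (mul_nonneg (hpos p) (sq_nonneg _)) (sq_nonneg _))
        fun p _ => le_of_eq ?_).trans ?_
      · have h3 : χ j p ^ 3 = χ j p := expectation_cube hcl j.1 j.2 p
        have h4 : χ j p ^ 2 * χ j p ^ 2 = χ j p ^ 2 := by
          calc χ j p ^ 2 * χ j p ^ 2 = χ j p ^ 3 * χ j p := by ring
            _ = _ := by rw [h3, pow_two]
        calc ((localEig p)⁻¹ * α p * χ j p) ^ 2
            = (localEig p)⁻¹ ^ 2 * α p ^ 2 * χ j p ^ 2 := by ring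
          _ = (localEig p)⁻¹ ^ 2 * α p ^ 2 * (χ j p ^ 2 * χ j p ^ 2) := by rw [h4]
          _ = _ := by ring
      · refine mul_le_mul_of_nonneg_left ?_
          (Finset.sum_nonneg fun p _ => mul_nonneg (hpos p) (sq_nonneg _))
        exact Finset.sum_le_sum_of_subset_of_nonneg (Finset.subset_univ _)
          fun p _ _ => mul_nonneg (mul_nonneg (hpos p) (sq_nonneg _)) (sq_nonneg _)
    have hsecond : ∀ p, ∑ j, w j * χ j p ^ 2 = Fintype.card ι ^ n * localEig p := fun p => by
      have h1 := sum_localFamily_pauliString_sq (n := n) hcl hW p σ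
      rw [hσ1, mul_one] at h1
      have h2 : ∀ j : (Fin n → ι) × Bits n,
          (state (localFamily W) j.1 j.2 * pauliString p).trace ^ 2 *
            (state (localFamily W) j.1 j.2 * σ).trace = ((w j * χ j p ^ 2 : ℝ) : ℂ) := fun j => by
        rw [re_trace_mul_comm_real (state_posSemidef _ _ _).1 (isHermitian_pauliString p),
          re_trace_mul_comm_real (state_posSemidef _ _ _).1 hσ.1, hw, hχ]
        push_cast
        ring
      simp only [h2, ← Complex.ofReal_sum] at h1
      exact_mod_cast h1
    have hpars : ∑ p, α p ^ 2 ≤ opNorm A ^ 2 := by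
      have h1 := sum_trace_mul_trace A A
      have h2 := re_trace_mul_le_opNorm (posSemidef_maximallyMixed (n := n)) (A * A)
      rw [trace_maximallyMixed, Complex.one_re, mul_one, Matrix.smul_mul, Matrix.one_mul,
        Matrix.trace_smul] at h2
      have h3 : ((∑ p, α p ^ 2 : ℝ) : ℂ) = ((2 : ℂ) ^ n)⁻¹ • (A * A).trace := by
        push_cast
        simp only [← hαc, mul_pow, ← Finset.mul_sum, pow_two (pauliString _ * A).trace]
        rw [h1, smul_eq_mul]
        field_simp
      rw [← h3, Complex.ofReal_re] at h2
      exact h2.trans ((opNorm_mul_le A A).trans_eq (pow_two _).symm)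
    rw [hcard]
    push_cast
    rw [inv_mul_le_iff₀ (by positivity)]
    calc ∑ j, w j * (state (localFamily W) j.1 j.2 * B).trace.re ^ 2
        ≤ ∑ j, w j * (4 ^ suppSize A * ∑ p, (localEig p)⁻¹ * α p ^ 2 * χ j p ^ 2) :=
          Finset.sum_le_sum fun j _ => mul_le_mul_of_nonneg_left (hCS j) (hw0 j)
      _ = 4 ^ suppSize A * ∑ p, (localEig p)⁻¹ * α p ^ 2 * ∑ j, w j * χ j p ^ 2 := by
          simp only [Finset.mul_sum]
          rw [Finset.sum_comm]
          exact Finset.sum_congr rfl fun _ _ => Finset.sum_congr rfl fun _ _ => by ring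
      _ = Fintype.card ι ^ n * (4 ^ suppSize A * ∑ p, α p ^ 2) := by
          simp only [hsecond, Finset.mul_sum]
          refine Finset.sum_congr rfl fun p _ => ?_
          have := (localEig_pos p).ne'
          field_simp
      _ ≤ _ := by gcongr

theorem isShadowFrame_local_rep :
    IsShadowFrame (localFamily CliffordClass.rep : (Fin n → CliffordClass 1) → Op n)
      fun A => 4 ^ suppSize A * opNorm A ^ 2 :=
  isShadowFrame_localFamily CliffordClass.isClifford_rep cliffordInvariant_rep

theorem isShadowFrame_local_conjTranspose_rep :
    IsShadowFrame (fun c : Fin n → CliffordClass 1 =>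
      (localFamily CliffordClass.rep c).conjTranspose)
      fun A => 4 ^ suppSize A * opNorm A ^ 2 := by
  have h := isShadowFrame_localFamily (n := n)
    (fun c : CliffordClass 1 => c.isClifford_rep.conjTranspose) cliffordInvariant_conjTranspose_rep
  convert h using 2 with c
  rw [localFamily, conjTranspose_tensor]
  rfl

/-- The states that enter a run: `U |b⟩⟨b| U†` for the ensembles of the procedure. -/
theorem isShadowFrame_ensemble (k : EnsembleKind) : IsShadowFrame (ensemble n k).U (f k) := by
  cases k
  · exact isShadowFrame_local_rep
  · exact isShadowFrame_rep

/-- The states that are measured in a run: `U† |b⟩⟨b| U` for the ensembles of the procedure. -/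
theorem isShadowFrame_conjTranspose_ensemble (k : EnsembleKind) :
    IsShadowFrame (fun u => ((ensemble n k).U u).conjTranspose) (f k) := by
  cases k
  · exact isShadowFrame_local_conjTranspose_rep
  · exact isShadowFrame_conjTranspose_rep

/-! ### The single-shot estimator -/

variable {Uin Uout : Ensemble n}

/-- The state prepared in a run. -/
def inState (z : Record Uin Uout) : Op n := state Uin.U z.uIn z.bIn

/-- The state on which the outcome of a run projects. -/
def outState (z : Record Uin Uout) : Op n :=
  state (fun u => (Uout.U u).conjTranspose) z.uOut z.bOut

theorem inState_posSemidef (z : Record Uin Uout) : (inState z).PosSemidef :=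
  state_posSemidef _ _ _

theorem outState_posSemidef (z : Record Uin Uout) : (outState z).PosSemidef :=
  state_posSemidef _ _ _

theorem proj_eq_kronecker (z : Record Uin Uout) :
    proj z = (inState z).transpose ⊗ₖ outState z := by
  have h : ∀ (U : Op n) (b x y : Bits n), (U * Matrix.single b b 1 * U.conjTranspose : Op n) x y =
      U x b * star (U y b) := fun U b x y => by
    rw [Matrix.mul_assoc, Matrix.mul_apply, Finset.sum_eq_single b]
    · rw [Matrix.single_mul_apply_same, one_mul, Matrix.conjTranspose_apply]
    · intro c _ hc
      rw [Matrix.single_mul_apply_of_ne _ _ _ _ _ hc, mul_zero]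
    · simp
  ext w w'
  rw [Matrix.kronecker_apply, Matrix.transpose_apply, inState, outState, state, state, h, h, proj,
    Matrix.vecMulVec_apply, ket, Pi.star_apply, ket]
  simp only [Matrix.mulVec_single_one, Matrix.col_apply, Matrix.map_apply,
    Matrix.conjTranspose_apply, star_mul', star_star]
  ring

theorem trace_proj_mul_kronecker (z : Record Uin Uout) (X Y : Op n) :
    (proj z * (X.transpose ⊗ₖ Y)).trace = (inState z * X).trace * (outState z * Y).trace := by
  rw [proj_eq_kronecker, ← Matrix.mul_kronecker_mul, Matrix.trace_kronecker,
    ← Matrix.transpose_mul, Matrix.trace_transpose, Matrix.trace_mul_comm]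

/-- The records, as pairs of an input and an output. -/
def recordEquiv (Uin Uout : Ensemble n) :
    (Uin.Index × Bits n) × (Uout.Index × Bits n) ≃ Record Uin Uout where
  toFun j := ⟨j.1.2, j.1.1, j.2.1, j.2.2⟩
  invFun z := ((z.uIn, z.bIn), (z.uOut, z.bOut))
  left_inv _ := rfl
  right_inv _ := rfl

instance (Uin Uout : Ensemble n) : Fintype (Record Uin Uout) :=
  Fintype.ofEquiv _ (recordEquiv Uin Uout)

theorem measurementMap_apply (A : Op2 n) :
    measurementMap Uin Uout A =
      ((Fintype.card Uin.Index : ℂ)⁻¹ * (Fintype.card Uout.Index : ℂ)⁻¹) •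
        ∑ z : Record Uin Uout, (proj z * A).trace • proj z := by
  rw [← Equiv.sum_comp (recordEquiv Uin Uout)]
  simp only [Fintype.sum_prod_type]
  simp only [measurementMap, LinearMap.smul_apply, LinearMap.coe_sum, Finset.sum_apply,
    LinearMap.smulRight_apply, LinearMap.comp_apply, LinearMap.mulLeft_apply,
    Matrix.traceLinearMap_apply, recordEquiv, Equiv.coe_fn_mk]
  congr 1
  refine Finset.sum_congr rfl fun u _ => ?_
  rw [Finset.sum_comm]

/-- The measurement map is self-adjoint for the trace form. -/
theorem trace_measurementMap_mul (A B : Op2 n) :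
    (measurementMap Uin Uout A * B).trace = (A * measurementMap Uin Uout B).trace := by
  rw [measurementMap_apply, measurementMap_apply, Matrix.smul_mul, Matrix.mul_smul,
    Matrix.trace_smul, Matrix.trace_smul, Matrix.sum_mul, Matrix.mul_sum, Matrix.trace_sum,
    Matrix.trace_sum]
  congr 1
  refine Finset.sum_congr rfl fun z _ => ?_
  rw [Matrix.smul_mul, Matrix.mul_smul, Matrix.trace_smul, Matrix.trace_smul,
    Matrix.trace_mul_comm A, smul_eq_mul, smul_eq_mul, mul_comm]

theorem sum_smul_transpose_kronecker {J J' : Type*} [Fintype J] [Fintype J'] (a : J → ℂ)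
    (b : J' → ℂ) (X : J → Op n) (Y : J' → Op n) :
    ∑ j, ∑ k, (a j * b k) • ((X j).transpose ⊗ₖ Y k) =
      (∑ j, a j • X j).transpose ⊗ₖ ∑ k, b k • Y k := by
  ext ⟨x, y⟩ ⟨x', y'⟩
  simp only [Matrix.sum_apply, Matrix.smul_apply, Matrix.kronecker_apply, Matrix.transpose_apply,
    smul_eq_mul]
  rw [Finset.sum_mul_sum]
  exact Finset.sum_congr rfl fun _ _ => Finset.sum_congr rfl fun _ _ => by ring

/-- The measurement map factors over the two registers. -/
theorem measurementMap_kronecker (X Y : Op n) :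
    measurementMap Uin Uout (X.transpose ⊗ₖ Y) =
      ((Fintype.card Uin.Index : ℂ)⁻¹ • ∑ j : Uin.Index × Bits n,
        (state Uin.U j.1 j.2 * X).trace • state Uin.U j.1 j.2).transpose ⊗ₖ
      ((Fintype.card Uout.Index : ℂ)⁻¹ • ∑ k : Uout.Index × Bits n,
        (state (fun u => (Uout.U u).conjTranspose) k.1 k.2 * Y).trace •
          state (fun u => (Uout.U u).conjTranspose) k.1 k.2) := by
  rw [measurementMap_apply, ← Equiv.sum_comp (recordEquiv Uin Uout), Fintype.sum_prod_type]
  simp only [trace_proj_mul_kronecker]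
  simp only [proj_eq_kronecker]
  rw [Matrix.transpose_smul, Matrix.smul_kronecker, Matrix.kronecker_smul, smul_smul]
  rw [← sum_smul_transpose_kronecker]
  rfl

/-- The range contains all matrix units of the two registers. -/
theorem isUnit_measurementMap {gin gout : Op n → ℝ} (hin : IsShadowFrame Uin.U gin)
    (hout : IsShadowFrame (fun u => (Uout.U u).conjTranspose) gout) :
    IsUnit (measurementMap Uin Uout) := by
  rw [LinearMap.isUnit_iff_range_eq_top, eq_top_iff]
  intro A _
  rw [Matrix.matrix_eq_sum_single A]
  refine Submodule.sum_mem _ fun w _ => Submodule.sum_mem _ fun w' _ => ?_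
  obtain ⟨B, hB, -⟩ := hin.exists_preimage (Matrix.single w'.1 w.1 1)
  obtain ⟨D, hD, -⟩ := hout.exists_preimage (Matrix.single w.2 w'.2 (A w w'))
  refine ⟨B.transpose ⊗ₖ D, ?_⟩
  rw [measurementMap_kronecker, hB, hD, Matrix.transpose_single, Matrix.single_kronecker_single,
    one_mul]

theorem trace_shadow_mul (h : IsUnit (measurementMap Uin Uout)) (z : Record Uin Uout)
    (T : Op2 n) : (shadow z * measurementMap Uin Uout T).trace = (proj z * T).trace := by
  rw [← trace_measurementMap_mul, shadow, ← Module.End.mul_apply, Ring.mul_inverse_cancel _ h,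
    Module.End.one_apply]

/-- The estimator factors over the registers: it pairs the states of the record with preimages `B`,
`D` of `ρ`, `O`. -/
theorem estimator_eq (h : IsUnit (measurementMap Uin Uout)) {ρ O B D : Op n}
    (hB : (Fintype.card Uin.Index : ℂ)⁻¹ • ∑ j : Uin.Index × Bits n,
      (state Uin.U j.1 j.2 * B).trace • state Uin.U j.1 j.2 = ρ)
    (hD : (Fintype.card Uout.Index : ℂ)⁻¹ • ∑ k : Uout.Index × Bits n,
      (state (fun u => (Uout.U u).conjTranspose) k.1 k.2 * D).trace •
        state (fun u => (Uout.U u).conjTranspose) k.1 k.2 = O)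
    (hBh : B.IsHermitian) (hDh : D.IsHermitian) (z : Record Uin Uout) :
    estimator ρ O z = 2 ^ n * ((inState z * B).trace.re * (outState z * D).trace.re) := by
  have h1 : measurementMap Uin Uout (B.transpose ⊗ₖ D) = ρ.transpose ⊗ₖ O := by
    rw [measurementMap_kronecker, hB, hD]
  have h2 : (2 : ℂ) ^ n = ((2 ^ n : ℝ) : ℂ) := by push_cast; rfl
  rw [estimator, ← h1, trace_shadow_mul h, trace_proj_mul_kronecker,
    re_trace_mul_comm_real (inState_posSemidef z).1 hBh,
    re_trace_mul_comm_real (outState_posSemidef z).1 hDh, h2, ← Complex.ofReal_mul,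
    ← Complex.ofReal_mul, Complex.ofReal_re, Complex.ofReal_re, Complex.ofReal_re]

theorem recordProb_eq (E : Op n →ₗ[ℂ] Op n) (z : Record Uin Uout) :
    recordProb E z = (2 ^ n : ℝ)⁻¹ * (Fintype.card Uin.Index : ℝ)⁻¹ *
      (Fintype.card Uout.Index : ℝ)⁻¹ * (outState z * E (inState z)).trace.re := by
  rw [recordProb, outState, trace_state_mul, Matrix.conjTranspose_conjTranspose, inState, state]

/-- Channels preserve positivity: complete positivity with a one-dimensional ancilla. -/
theorem IsChannel.posSemidef {E : Op n →ₗ[ℂ] Op n} (hE : IsChannel E) {σ : Op n}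
    (hσ : σ.PosSemidef) : (E σ).PosSemidef := by
  have h1 := hE.completelyPositive 1 (σ.submatrix Prod.snd Prod.snd) (hσ.submatrix _)
  exact h1.submatrix fun x : Bits n => ((0 : Fin 1), x)

/-- The single-shot estimator is unbiased. -/
theorem sum_recordProb_mul_estimator {gin gout : Op n → ℝ} (hin : IsShadowFrame Uin.U gin)
    (hout : IsShadowFrame (fun u => (Uout.U u).conjTranspose) gout)
    {E : Op n →ₗ[ℂ] Op n} (hE : IsChannel E) {ρ O : Op n} (hρ : ρ.IsHermitian)
    (hO : O.IsHermitian) :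
    ((∑ z : Record Uin Uout, recordProb E z * estimator ρ O z : ℝ) : ℂ) = (E ρ * O).trace := by
  obtain ⟨B, hB, hB2⟩ := hin.exists_preimage ρ
  obtain ⟨D, hD, hD2⟩ := hout.exists_preimage O
  have hest := estimator_eq (isUnit_measurementMap hin hout) hB hD (hB2 hρ).1 (hD2 hO).1
  have hd : (2 ^ n : ℂ) ≠ 0 := pow_ne_zero n two_ne_zero
  have h1 : ∀ j k, ((recordProb E (recordEquiv Uin Uout (j, k)) *
      estimator ρ O (recordEquiv Uin Uout (j, k)) : ℝ) : ℂ) =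
      (Fintype.card Uin.Index : ℂ)⁻¹ * ((state Uin.U j.1 j.2 * B).trace *
        ((Fintype.card Uout.Index : ℂ)⁻¹ *
          ((state (fun u => (Uout.U u).conjTranspose) k.1 k.2 * D).trace *
            (state (fun u => (Uout.U u).conjTranspose) k.1 k.2 *
              E (state Uin.U j.1 j.2)).trace))) := fun j k => by
    rw [hest, recordProb_eq]
    simp only [inState, outState, recordEquiv, Equiv.coe_fn_mk]
    rw [re_trace_mul_comm_real (state_posSemidef Uin.U j.1 j.2).1 (hB2 hρ).1,
      re_trace_mul_comm_real (state_posSemidef _ k.1 k.2).1 (hD2 hO).1,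
      re_trace_mul_comm_real (state_posSemidef _ k.1 k.2).1
        (hE.posSemidef (state_posSemidef Uin.U j.1 j.2)).1]
    simp only [Complex.ofReal_re]
    push_cast
    field_simp
  have h2 : ∀ j : Uin.Index × Bits n, ∑ k : Uout.Index × Bits n,
      (Fintype.card Uin.Index : ℂ)⁻¹ * ((state Uin.U j.1 j.2 * B).trace *
        ((Fintype.card Uout.Index : ℂ)⁻¹ *
          ((state (fun u => (Uout.U u).conjTranspose) k.1 k.2 * D).trace *
            (state (fun u => (Uout.U u).conjTranspose) k.1 k.2 *
              E (state Uin.U j.1 j.2)).trace))) =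
      (Fintype.card Uin.Index : ℂ)⁻¹ *
        ((state Uin.U j.1 j.2 * B).trace * (O * E (state Uin.U j.1 j.2)).trace) := fun j => by
    rw [← Finset.mul_sum, ← Finset.mul_sum, ← Finset.mul_sum]
    conv_rhs => rw [← hD]
    rw [Matrix.smul_mul, Matrix.trace_smul, Matrix.sum_mul, Matrix.trace_sum]
    simp only [Matrix.smul_mul, Matrix.trace_smul, smul_eq_mul]
  rw [Complex.ofReal_sum, ← Equiv.sum_comp (recordEquiv Uin Uout), Fintype.sum_prod_type]
  simp only [h1, h2]
  rw [← Finset.mul_sum, Matrix.trace_mul_comm (E ρ)]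
  conv_rhs => rw [← hB]
  rw [map_smul, map_sum, Matrix.mul_smul, Matrix.trace_smul, Matrix.mul_sum, Matrix.trace_sum]
  simp only [map_smul, Matrix.mul_smul, Matrix.trace_smul, smul_eq_mul]

/-- The second moment of the single-shot estimator. The output register is bounded first, for each
prepared state separately; then the input register. -/
theorem sum_recordProb_mul_estimator_sq_le {gin gout : Op n → ℝ} (hin : IsShadowFrame Uin.U gin)
    (hout : IsShadowFrame (fun u => (Uout.U u).conjTranspose) gout)
    {E : Op n →ₗ[ℂ] Op n} (hE : IsChannel E) {ρ O : Op n} (hρ : ρ.IsHermitian)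
    (hO : O.IsHermitian) :
    ∑ z : Record Uin Uout, recordProb E z * estimator ρ O z ^ 2 ≤ 4 ^ n * (gin ρ * gout O) := by
  obtain ⟨B, hB, hB2⟩ := hin.exists_preimage ρ
  obtain ⟨D, hD, hD2⟩ := hout.exists_preimage O
  have hest := estimator_eq (isUnit_measurementMap hin hout) hB hD (hB2 hρ).1 (hD2 hO).1
  set φ := fun k : Uout.Index × Bits n => state (fun u => (Uout.U u).conjTranspose) k.1 k.2
    with hφ
  set ψ := fun j : Uin.Index × Bits n => state Uin.U j.1 j.2 with hψ
  have hd : (2 ^ n : ℝ) ≠ 0 := pow_ne_zero n two_ne_zero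
  have hmix : ∀ X : Op n, X.trace = 1 →
      (X * (((2 : ℂ) ^ n)⁻¹ • (1 : Op n))).trace.re = (2 ^ n)⁻¹ := fun X hX => by
    have h2 : ((2 : ℂ) ^ n)⁻¹ = (((2 ^ n)⁻¹ : ℝ) : ℂ) := by push_cast; rfl
    rw [Matrix.mul_smul, Matrix.mul_one, Matrix.trace_smul, hX, smul_eq_mul, mul_one, h2,
      Complex.ofReal_re]
  -- The input string is uniform: its weight `2⁻ⁿ` is the outcome probability of measuring the
  -- maximally mixed state, so the bound for the input frame applies to that state.
  have hinb := (hB2 hρ).2 _ posSemidef_maximallyMixed trace_maximallyMixed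
  have hout0 : 0 ≤ gout O := by
    refine le_trans ?_ ((hD2 hO).2 _ posSemidef_maximallyMixed trace_maximallyMixed)
    refine mul_nonneg (by positivity) (Finset.sum_nonneg fun k _ => ?_)
    rw [hmix _ (trace_state (W := fun u => (Uout.U u).conjTranspose) (hout.unitary _) _)]
    positivity
  have houtb : ∀ j, (Fintype.card Uout.Index : ℝ)⁻¹ *
      ∑ k, (φ k * E (ψ j)).trace.re * (φ k * D).trace.re ^ 2 ≤ gout O := fun j =>
    (hD2 hO).2 _ (hE.posSemidef (state_posSemidef _ _ _))
      ((hE.tracePreserving _).trans (trace_state (hin.unitary _) _))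
  have h4 : (4 : ℝ) ^ n = 2 ^ n * 2 ^ n := by rw [← mul_pow]; norm_num
  have h1 : ∀ j k, recordProb E (recordEquiv Uin Uout (j, k)) *
      estimator ρ O (recordEquiv Uin Uout (j, k)) ^ 2 =
      4 ^ n * (Fintype.card Uin.Index : ℝ)⁻¹ * ((2 ^ n)⁻¹ * (ψ j * B).trace.re ^ 2) *
        ((Fintype.card Uout.Index : ℝ)⁻¹ *
          ((φ k * E (ψ j)).trace.re * (φ k * D).trace.re ^ 2)) := fun j k => by
    rw [hest, recordProb_eq, h4]
    simp only [inState, outState, recordEquiv, Equiv.coe_fn_mk, hφ, hψ]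
    field_simp
  rw [← Equiv.sum_comp (recordEquiv Uin Uout), Fintype.sum_prod_type]
  simp only [h1, ← Finset.mul_sum]
  calc ∑ j, 4 ^ n * (Fintype.card Uin.Index : ℝ)⁻¹ * ((2 ^ n)⁻¹ * (ψ j * B).trace.re ^ 2) *
        ((Fintype.card Uout.Index : ℝ)⁻¹ *
          ∑ k, (φ k * E (ψ j)).trace.re * (φ k * D).trace.re ^ 2)
      ≤ ∑ j, 4 ^ n * (Fintype.card Uin.Index : ℝ)⁻¹ * ((2 ^ n)⁻¹ * (ψ j * B).trace.re ^ 2) *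
        gout O := Finset.sum_le_sum fun j _ =>
          mul_le_mul_of_nonneg_left (houtb j) (by positivity)
    _ = 4 ^ n * (((Fintype.card Uin.Index : ℝ)⁻¹ *
          ∑ j, (2 ^ n)⁻¹ * (ψ j * B).trace.re ^ 2) * gout O) := by
        rw [← Finset.sum_mul, ← Finset.mul_sum]
        ring
    _ ≤ 4 ^ n * (gin ρ * gout O) := by
        refine mul_le_mul_of_nonneg_left (mul_le_mul_of_nonneg_right ?_ hout0) (by positivity)
        refine le_trans (le_of_eq ?_) hinb
        congr 1
        refine Finset.sum_congr rfl fun j _ => ?_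
        rw [hmix _ (trace_state (hin.unitary _) _)]

/-! ### The median of means -/

/-- If the median deviates from `θ` by more than `ε`, then so do at least half of the numbers. -/
theorem le_two_mul_card_of_lt_abs_median {K : ℕ} (hK : 0 < K) (x : Fin K → ℝ) {θ ε : ℝ}
    (h : ε < |median x - θ|) :
    K ≤ 2 * (Finset.univ.filter fun k => ε < |x k - θ|).card := by
  rw [median, dif_pos hK] at h
  set i : Fin K := ⟨(K - 1) / 2, by omega⟩
  set j : Fin K := ⟨K / 2, by omega⟩
  have hmono : Monotone (x ∘ Tuple.sort x) := Tuple.monotone_sort x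
  have hij : x (Tuple.sort x i) ≤ x (Tuple.sort x j) :=
    hmono (by simp only [i, j, Fin.mk_le_mk]; omega)
  rcases lt_abs.1 h with h1 | h1
  · have hsub : (Finset.Ici j).map (Tuple.sort x).toEmbedding ⊆
        Finset.univ.filter fun k => ε < |x k - θ| := by
      intro k hk
      obtain ⟨l, hl, rfl⟩ := Finset.mem_map.1 hk
      have h2 : x (Tuple.sort x j) ≤ x (Tuple.sort x l) := hmono (Finset.mem_Ici.1 hl)
      rw [Finset.mem_filter]
      refine ⟨Finset.mem_univ _, lt_abs.2 (Or.inl ?_)⟩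
      simp only [Equiv.coe_toEmbedding]
      linarith
    have hc := Finset.card_le_card hsub
    rw [Finset.card_map, Fin.card_Ici] at hc
    simp only [j] at hc
    omega
  · have hsub : (Finset.Iic i).map (Tuple.sort x).toEmbedding ⊆
        Finset.univ.filter fun k => ε < |x k - θ| := by
      intro k hk
      obtain ⟨l, hl, rfl⟩ := Finset.mem_map.1 hk
      have h2 : x (Tuple.sort x l) ≤ x (Tuple.sort x i) := hmono (Finset.mem_Iic.1 hl)
      rw [Finset.mem_filter]
      refine ⟨Finset.mem_univ _, lt_abs.2 (Or.inr ?_)⟩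
      simp only [Equiv.coe_toEmbedding]
      linarith
    have hc := Finset.card_le_card hsub
    rw [Finset.card_map, Fin.card_Iic] at hc
    simp only [i] at hc
    omega

open MeasureTheory ProbabilityTheory

/-- If each of `K` jointly independent events has probability at most `1 / 34`, then at least half
of them occur with probability at most `exp (-K / 2)`. The union bound over all `2 ^ K` sets of
events suffices, since `4 e ≤ 34`. -/
theorem measureReal_half_le_exp {Ω : Type*} [MeasurableSpace Ω] (μ : Measure Ω)
    [IsProbabilityMeasure μ] {K : ℕ} (A : Fin K → Set Ω) (hA : ∀ k, μ.real (A k) ≤ 1 / 34)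
    (hind : ∀ T : Finset (Fin K), μ.real (⋂ k ∈ T, A k) = ∏ k ∈ T, μ.real (A k)) :
    μ.real {ω | ∃ T : Finset (Fin K), K ≤ 2 * T.card ∧ ∀ k ∈ T, ω ∈ A k} ≤
      Real.exp (-(K / 2)) := by
  set r : ℝ := Real.exp (-(1 / 2)) / 2 with hr
  have hr0 : 0 ≤ r := by positivity
  have hr1 : r ≤ 1 := by
    have : Real.exp (-(1 / 2)) ≤ 1 := Real.exp_le_one_iff.2 (by norm_num)
    rw [hr]
    linarith
  have hr2 : 1 / 34 ≤ r ^ 2 := by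
    have h1 : r ^ 2 = (4 * Real.exp 1)⁻¹ := by
      rw [hr, div_pow, ← Real.exp_nat_mul, mul_inv, ← Real.exp_neg]
      norm_num
      ring
    rw [h1, one_div]
    refine inv_anti₀ (by positivity) ?_
    linarith [Real.exp_one_lt_d9]
  have hsub : {ω | ∃ T : Finset (Fin K), K ≤ 2 * T.card ∧ ∀ k ∈ T, ω ∈ A k} ⊆
      ⋃ T ∈ Finset.univ.filter fun T : Finset (Fin K) => K ≤ 2 * T.card, ⋂ k ∈ T, A k := by
    rintro ω ⟨T, hT, hω⟩
    simp only [Set.mem_iUnion, Set.mem_iInter, Finset.mem_filter, Finset.mem_univ, true_and]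
    exact ⟨T, hT, hω⟩
  calc μ.real {ω | ∃ T : Finset (Fin K), K ≤ 2 * T.card ∧ ∀ k ∈ T, ω ∈ A k}
      ≤ μ.real (⋃ T ∈ Finset.univ.filter fun T : Finset (Fin K) => K ≤ 2 * T.card,
          ⋂ k ∈ T, A k) := measureReal_mono hsub (measure_ne_top _ _)
    _ ≤ ∑ T ∈ Finset.univ.filter fun T : Finset (Fin K) => K ≤ 2 * T.card,
          μ.real (⋂ k ∈ T, A k) := measureReal_biUnion_finset_le _ _
    _ ≤ ∑ _T ∈ Finset.univ.filter fun T : Finset (Fin K) => K ≤ 2 * T.card, r ^ K := by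
        refine Finset.sum_le_sum fun T hT => ?_
        rw [hind]
        calc ∏ k ∈ T, μ.real (A k) ≤ ∏ _k ∈ T, r ^ 2 :=
              Finset.prod_le_prod (fun _ _ => measureReal_nonneg) fun k _ => (hA k).trans hr2
          _ = r ^ (2 * T.card) := by rw [Finset.prod_const, ← pow_mul]
          _ ≤ r ^ K := pow_le_pow_of_le_one hr0 hr1 (Finset.mem_filter.1 hT).2
    _ ≤ 2 ^ K * r ^ K := by
        rw [Finset.sum_const, nsmul_eq_mul]
        refine mul_le_mul_of_nonneg_right ?_ (pow_nonneg hr0 _)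
        have : (Finset.univ.filter fun T : Finset (Fin K) => K ≤ 2 * T.card).card ≤ 2 ^ K :=
          (Finset.card_filter_le _ _).trans_eq (by simp)
        exact_mod_cast this
    _ = Real.exp (-(K / 2)) := by
        rw [← mul_pow, hr, mul_div_cancel₀ _ two_ne_zero, ← Real.exp_nat_mul]
        congr 1
        ring

section

variable {Ω : Type*} [MeasurableSpace Ω] {μ : Measure Ω} {K N : ℕ}
  {X : Fin K × Fin N → Ω → ℝ}

/-- The mean of the `k`-th batch. -/
def batchMean (X : Fin K × Fin N → Ω → ℝ) (k : Fin K) (ω : Ω) : ℝ := (∑ i, X (k, i) ω) / N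

/-- Different batches are independent. -/
theorem measureReal_iInter_batchMean (hX : ∀ i, Measurable (X i)) (hind : iIndepFun X μ)
    {B : Set ℝ} (hB : MeasurableSet B) (T : Finset (Fin K)) :
    μ.real (⋂ k ∈ T, batchMean X k ⁻¹' B) = ∏ k ∈ T, μ.real (batchMean X k ⁻¹' B) := by
  have := hind.isProbabilityMeasure
  induction T using Finset.induction_on with
  | empty => simp
  | insert k₀ T hk₀ ih =>
    rw [Finset.prod_insert hk₀, Finset.set_biInter_insert, ← ih]
    let S₁ : Finset (Fin K × Fin N) := Finset.univ.filter fun j => j.1 = k₀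
    let S₂ : Finset (Fin K × Fin N) := Finset.univ.filter fun j => j.1 ∈ T
    have hdisj : Disjoint S₁ S₂ := by
      rw [Finset.disjoint_left]
      intro j h1 h2
      have h1' := (Finset.mem_filter.1 h1).2
      have h2' := (Finset.mem_filter.1 h2).2
      rw [h1'] at h2'
      exact hk₀ h2'
    have hIF := hind.indepFun_finset S₁ S₂ hdisj hX
    let F₁ : Set (S₁ → ℝ) := {u | (∑ i : Fin N, u ⟨(k₀, i), by simp [S₁]⟩) / (N : ℝ) ∈ B}
    let F₂ : Set (S₂ → ℝ) :=
      ⋂ k : T, {u | (∑ i : Fin N, u ⟨(k.1, i), by simp [S₂, k.2]⟩) / (N : ℝ) ∈ B}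
    have hF₁ : MeasurableSet F₁ := by
      refine measurableSet_preimage (f := fun u : S₁ → ℝ =>
        (∑ i : Fin N, u ⟨(k₀, i), by simp [S₁]⟩) / (N : ℝ)) ?_ hB
      fun_prop
    have hF₂ : MeasurableSet F₂ := by
      refine MeasurableSet.iInter fun k => ?_
      refine measurableSet_preimage (f := fun u : S₂ → ℝ =>
        (∑ i : Fin N, u ⟨(k.1, i), by simp [S₂, k.2]⟩) / (N : ℝ)) ?_ hB
      fun_prop
    have h := hIF.measure_inter_preimage_eq_mul F₁ F₂ hF₁ hF₂
    have e₁ : (fun ω (i : S₁) => X i ω) ⁻¹' F₁ = batchMean X k₀ ⁻¹' B := rfl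
    have e₂ : (fun ω (i : S₂) => X i ω) ⁻¹' F₂ = ⋂ k ∈ T, batchMean X k ⁻¹' B := by
      ext ω
      simp [F₂, batchMean]
    rw [e₁, e₂] at h
    rw [measureReal_def, h, ENNReal.toReal_mul]
    rfl

/-- Chebyshev's inequality for a batch mean. -/
theorem measureReal_batchMean_le [IsProbabilityMeasure μ] (hX : ∀ i, Measurable (X i))
    (hind : iIndepFun X μ) {C θ V ε : ℝ}
    (hC : ∀ i ω, |X i ω| ≤ C) (hθ : ∀ i, ∫ ω, X i ω ∂μ = θ) (hV : ∀ i, ∫ ω, X i ω ^ 2 ∂μ ≤ V)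
    (hε : 0 < ε) (hN0 : 0 < N) (hN : 34 * V ≤ ε ^ 2 * N) (k : Fin K) :
    μ.real (batchMean X k ⁻¹' {y | ε < |y - θ|}) ≤ 1 / 34 := by
  have hN' : (0 : ℝ) < N := by exact_mod_cast hN0
  have hL : ∀ i, MemLp (X i) 2 μ := fun i =>
    MemLp.of_bound (hX i).aestronglyMeasurable C (Filter.Eventually.of_forall fun ω => by
      rw [Real.norm_eq_abs]; exact hC i ω)
  have hvar : ∀ i, Var[X i; μ] ≤ V := fun i =>
    (variance_le_expectation_sq (hX i).aestronglyMeasurable).trans (hV i)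
  set Y : Ω → ℝ := ∑ i : Fin N, X (k, i) with hY
  have hbY : batchMean X k = fun ω => (N : ℝ)⁻¹ * Y ω := by
    funext ω
    simp [batchMean, hY, div_eq_inv_mul]
  have hYL : MemLp Y 2 μ := memLp_finsetSum' _ fun i _ => hL (k, i)
  have hYvar : Var[Y; μ] ≤ N * V := by
    rw [hY, IndepFun.variance_sum (fun i _ => hL (k, i)) fun i _ j _ hij =>
      hind.indepFun fun h => hij (by simpa using h)]
    calc ∑ i : Fin N, Var[X (k, i); μ] ≤ ∑ _i : Fin N, V :=
          Finset.sum_le_sum fun i _ => hvar (k, i)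
      _ = N * V := by simp
  have hmean : ∫ ω, batchMean X k ω ∂μ = θ := by
    have h1 : ∫ ω, Y ω ∂μ = N * θ := by
      simp only [hY, Finset.sum_apply]
      rw [integral_finsetSum _ fun i _ => (hL (k, i)).integrable one_le_two]
      simp [hθ]
    rw [hbY, integral_const_mul, h1]
    field_simp
  have hbL : MemLp (batchMean X k) 2 μ := by
    rw [hbY]
    exact hYL.const_mul _
  have hbvar : Var[batchMean X k; μ] ≤ V / N := by
    rw [hbY, variance_const_mul]
    calc ((N : ℝ)⁻¹) ^ 2 * Var[Y; μ] ≤ ((N : ℝ)⁻¹) ^ 2 * (N * V) := by gcongr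
      _ = V / N := by field_simp
  have hcheb := meas_ge_le_variance_div_sq hbL hε
  rw [hmean] at hcheb
  have hsub : batchMean X k ⁻¹' {y | ε < |y - θ|} ⊆ {ω | ε ≤ |batchMean X k ω - θ|} :=
    fun ω hω => by
      simp only [Set.mem_preimage, Set.mem_ofPred_eq] at hω ⊢
      exact hω.le
  calc μ.real (batchMean X k ⁻¹' {y | ε < |y - θ|})
      ≤ μ.real {ω | ε ≤ |batchMean X k ω - θ|} := measureReal_mono hsub
    _ ≤ Var[batchMean X k; μ] / ε ^ 2 :=
        ENNReal.toReal_le_of_le_ofReal (div_nonneg (variance_nonneg _ _) (sq_nonneg _)) hcheb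
    _ ≤ (V / N) / ε ^ 2 := by gcongr
    _ ≤ 1 / 34 := by
        rw [div_div, div_le_div_iff₀ (by positivity) (by norm_num)]
        linarith

/-- The failure probability of the median of means. -/
theorem measureReal_median_batchMean_le [IsProbabilityMeasure μ] (hX : ∀ i, Measurable (X i))
    (hind : iIndepFun X μ) {C θ V ε : ℝ} (hC : ∀ i ω, |X i ω| ≤ C) (hθ : ∀ i, ∫ ω, X i ω ∂μ = θ)
    (hV : ∀ i, ∫ ω, X i ω ^ 2 ∂μ ≤ V) (hε : 0 < ε) (hK0 : 0 < K) (hN0 : 0 < N)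
    (hN : 34 * V ≤ ε ^ 2 * N) :
    μ.real {ω | ε < |median (fun k => batchMean X k ω) - θ|} ≤ Real.exp (-(K / 2)) := by
  have hB : MeasurableSet {y : ℝ | ε < |y - θ|} :=
    measurableSet_lt measurable_const (by fun_prop)
  refine (measureReal_mono ?_).trans (measureReal_half_le_exp μ
    (fun k => batchMean X k ⁻¹' {y | ε < |y - θ|})
    (measureReal_batchMean_le hX hind hC hθ hV hε hN0 hN)
    (measureReal_iInter_batchMean hX hind hB))
  intro ω hω
  exact ⟨_, le_two_mul_card_of_lt_abs_median hK0 _ hω, fun k hk => (Finset.mem_filter.1 hk).2⟩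

end

/-! ### The guarantee for the shadow estimators -/

open MeasureTheory ProbabilityTheory

theorem recordProb_nonneg {n : ℕ} {Uin Uout : Ensemble n} {E : Op n →ₗ[ℂ] Op n} (hE : IsChannel E)
    (z : Record Uin Uout) : 0 ≤ recordProb E z := by
  obtain ⟨C, hC, hC2⟩ := posSemidef_exists_sq (hE.posSemidef (inState_posSemidef z))
  rw [recordProb_eq, hC2]
  exact mul_nonneg (by positivity) (re_trace_mul_sq_nonneg (outState_posSemidef z) hC)

/-- Expectations over a run are sums over the finitely many records. -/
theorem integral_record {n : ℕ} {Uin Uout : Ensemble n} {E : Op n →ₗ[ℂ] Op n}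
    {Ω : Type*} [MeasurableSpace Ω] {μ : Measure Ω} [IsProbabilityMeasure μ]
    {Z : Ω → Record Uin Uout} (hZ : Measurable Z)
    (hlaw : ∀ z, μ.real (Z ⁻¹' {z}) = recordProb E z) (g : Record Uin Uout → ℝ) :
    ∫ ω, g (Z ω) ∂μ = ∑ z, recordProb E z * g z := by
  have hg : Measurable g := measurable_from_top
  have : IsProbabilityMeasure (μ.map Z) := Measure.isProbabilityMeasure_map hZ.aemeasurable
  have : MeasurableSingletonClass (Record Uin Uout) := ⟨fun _ => trivial⟩
  have hint : Integrable g (μ.map Z) :=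
    Integrable.of_bound hg.aestronglyMeasurable (∑ z, |g z|)
      (Filter.Eventually.of_forall fun z => by
        rw [Real.norm_eq_abs]
        exact Finset.single_le_sum (f := fun z => |g z|) (fun _ _ => abs_nonneg _)
          (Finset.mem_univ z))
  rw [← integral_map hZ.aemeasurable hg.aestronglyMeasurable, integral_fintype hint]
  refine Finset.sum_congr rfl fun z _ => ?_
  rw [map_measureReal_apply hZ (measurableSet_singleton z), hlaw, smul_eq_mul]

/-- An estimator whose second moment vanishes has mean zero. -/
theorem sum_recordProb_mul_eq_zero {n : ℕ} {Uin Uout : Ensemble n} {E : Op n →ₗ[ℂ] Op n}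
    (hE : IsChannel E) {g : Record Uin Uout → ℝ}
    (h : ∑ z, recordProb E z * g z ^ 2 ≤ 0) : ∑ z, recordProb E z * g z = 0 := by
  have h0 : ∀ z ∈ Finset.univ, 0 ≤ recordProb E z * g z ^ 2 := fun z _ =>
    mul_nonneg (recordProb_nonneg hE z) (sq_nonneg _)
  have h1 := (Finset.sum_eq_zero_iff_of_nonneg h0).1 (le_antisymm h (Finset.sum_nonneg h0))
  refine Finset.sum_eq_zero fun z hz => ?_
  rcases mul_eq_zero.1 (h1 z hz) with h2 | h2
  · rw [h2, zero_mul]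
  · rw [pow_eq_zero_iff two_ne_zero |>.1 h2, mul_zero]

theorem median_zero {K : ℕ} : median (fun _ : Fin K => 0) = 0 := by
  simp [median]

/-- The failure probability of the median-of-means estimator of a single pair `ρ`, `O`. -/
theorem measureReal_medianOfMeans_le {n N K : ℕ} (kin kout : EnsembleKind)
    {E : Op n →ₗ[ℂ] Op n} (hE : IsChannel E) {ρ O : Op n} (hρ : ρ.IsHermitian)
    (hO : O.IsHermitian) {ε : ℝ} (hε : 0 < ε) (hK : 0 < K)
    (hN : 34 * (4 ^ n * (f kin ρ * f kout O)) ≤ ε ^ 2 * N)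
    {Ω : Type*} [MeasurableSpace Ω] (μ : Measure Ω) [IsProbabilityMeasure μ]
    (Z : Fin K × Fin N → Ω → Record (ensemble n kin) (ensemble n kout))
    (hZ : ∀ i, Measurable (Z i)) (hindep : iIndepFun Z μ)
    (hlaw : ∀ i z, μ.real (Z i ⁻¹' {z}) = recordProb E z) :
    μ.real {ω | ε < ‖(E ρ * O).trace - (medianOfMeans ρ O (fun i => Z i ω) : ℂ)‖} ≤
      Real.exp (-(K / 2)) := by
  have hin := isShadowFrame_ensemble (n := n) kin
  have hout := isShadowFrame_conjTranspose_ensemble (n := n) kout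
  have hmean := sum_recordProb_mul_estimator hin hout hE hρ hO
  have hsq := sum_recordProb_mul_estimator_sq_le hin hout hE hρ hO
  set g : Record (ensemble n kin) (ensemble n kout) → ℝ := estimator ρ O with hg
  set θ := ∑ z, recordProb E z * g z with hθ
  have hnorm : ∀ ω, ‖(E ρ * O).trace - (medianOfMeans ρ O (fun i => Z i ω) : ℂ)‖ =
      |median (fun k => batchMean (fun i ω => g (Z i ω)) k ω) - θ| := fun ω => by
    rw [← hmean, ← Complex.ofReal_sub, Complex.norm_real, Real.norm_eq_abs, abs_sub_comm]
    rfl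
  simp only [hnorm]
  have hgm : Measurable g := measurable_from_top
  rcases Nat.eq_zero_or_pos N with hN0 | hN0
  -- With empty batches the estimator is the junk value `x / 0 = 0`; the hypothesis on `N` then
  -- forces the second moment, and with it the true value, to vanish.
  · subst hN0
    have hV : 4 ^ n * (f kin ρ * f kout O) ≤ 0 := by
      rw [Nat.cast_zero, mul_zero] at hN
      linarith
    have hθ0 : θ = 0 := sum_recordProb_mul_eq_zero hE (hsq.trans hV)
    have : ∀ ω, |median (fun k => batchMean (fun i ω => g (Z i ω)) k ω) - θ| = 0 := fun ω => by
      simp only [batchMean, Finset.univ_eq_empty, Finset.sum_empty, zero_div, median_zero, hθ0,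
        sub_zero, abs_zero]
    simp only [this, not_lt.2 hε.le, Set.ofPred_false, measureReal_empty]
    positivity
  · refine measureReal_median_batchMean_le (C := ∑ z, |g z|) (fun i => hgm.comp (hZ i))
      (hindep.comp (fun _ => g) fun _ => hgm) (fun i ω => ?_)
      (fun i => integral_record (hZ i) (hlaw i) g)
      (fun i => (integral_record (hZ i) (hlaw i) fun z => g z ^ 2).trans_le hsq) hε hK hN0 hN
    exact Finset.single_le_sum (f := fun z => |g z|) (fun _ _ => abs_nonneg _)
      (Finset.mem_univ (Z i ω))

end ShadowProcess

end

theorem theorem2 {n M L : ℕ} (kin kout : ShadowProcess.EnsembleKind)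
    (E : ShadowProcess.Op n →ₗ[ℂ] ShadowProcess.Op n) (hE : ShadowProcess.IsChannel E)
    (O : Fin M → ShadowProcess.Op n) (hO : ∀ j, (O j).IsHermitian)
    (ρ : Fin L → ShadowProcess.Op n) (hρ : ∀ l, (ρ l).IsHermitian)
    (ε δ : ℝ) (hε : 0 < ε) (hε1 : ε ≤ 1) (hδ : 0 < δ) (hδ1 : δ ≤ 1)
    (N K : ℕ) (hK : 2 * Real.log (2 * M * L / δ) ≤ K)
    (hN : 34 / ε ^ 2 * 4 ^ n *
      (⨆ p : Fin L × Fin M, ShadowProcess.f kin (ρ p.1) * ShadowProcess.f kout (O p.2)) ≤ N)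
    {Ω : Type*} [MeasurableSpace Ω] (μ : MeasureTheory.Measure Ω)
    [MeasureTheory.IsProbabilityMeasure μ]
    (Z : Fin K × Fin N → Ω →
      ShadowProcess.Record (ShadowProcess.ensemble n kin) (ShadowProcess.ensemble n kout))
    (hZ : ∀ i, Measurable (Z i))
    (hindep : ProbabilityTheory.iIndepFun Z μ)
    (hlaw : ∀ i z, μ.real (Z i ⁻¹' {z}) = ShadowProcess.recordProb E z) :
    1 - δ ≤ μ.real {ω | ∀ (j : Fin M) (k : Fin L),
      ‖(E (ρ k) * O j).trace -
        (ShadowProcess.medianOfMeans (ρ k) (O j) (fun i => Z i ω) : ℂ)‖ ≤ ε} := by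
  set good := {ω | ∀ (j : Fin M) (k : Fin L),
      ‖(E (ρ k) * O j).trace -
        (ShadowProcess.medianOfMeans (ρ k) (O j) (fun i => Z i ω) : ℂ)‖ ≤ ε} with hgood
  let bad : Fin L × Fin M → Set Ω := fun p => {ω | ε < ‖(E (ρ p.1) * O p.2).trace -
        (ShadowProcess.medianOfMeans (ρ p.1) (O p.2) (fun i => Z i ω) : ℂ)‖}
  have hcover : (Set.univ : Set Ω) ⊆ good ∪ ⋃ p, bad p := by
    intro ω _
    by_cases h : ω ∈ good
    · exact Or.inl h
    · simp only [hgood, Set.mem_ofPred_eq, not_forall, not_le] at h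
      obtain ⟨j, k, hjk⟩ := h
      exact Or.inr (Set.mem_iUnion.2 ⟨(k, j), hjk⟩)
  have hone : 1 ≤ μ.real good + ∑ p, μ.real (bad p) := by
    calc (1 : ℝ) = μ.real Set.univ := MeasureTheory.probReal_univ.symm
      _ ≤ μ.real (good ∪ ⋃ p, bad p) :=
          MeasureTheory.measureReal_mono hcover (MeasureTheory.measure_ne_top _ _)
      _ ≤ μ.real good + μ.real (⋃ p, bad p) := MeasureTheory.measureReal_union_le _ _
      _ ≤ _ := by gcongr; exact MeasureTheory.measureReal_iUnion_fintype_le _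
  have hbad : ∀ p, μ.real (bad p) ≤ δ / (2 * M * L) := by
    intro p
    have hM : (1 : ℝ) ≤ M := by exact_mod_cast p.2.pos
    have hL : (1 : ℝ) ≤ L := by exact_mod_cast p.1.pos
    have hML : 1 ≤ (M : ℝ) * L := one_le_mul_of_one_le_of_one_le hM hL
    have hpos : 0 < 2 * M * L / δ := by positivity
    -- A pair exists, so `2 M L / δ ≥ 2` and the hypothesis on `K` excludes `K = 0`.
    have hK0 : 0 < K := by
      have h1 : 1 < 2 * M * L / δ := by
        rw [lt_div_iff₀ hδ]
        linarith
      have h2 := Real.log_pos h1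
      have h3 : (0 : ℝ) < K := by linarith
      exact_mod_cast h3
    have hNp : 34 * (4 ^ n * (ShadowProcess.f kin (ρ p.1) * ShadowProcess.f kout (O p.2))) ≤
        ε ^ 2 * N := by
      have h1 := le_ciSup (f := fun p : Fin L × Fin M =>
        ShadowProcess.f kin (ρ p.1) * ShadowProcess.f kout (O p.2)) (Set.finite_range _).bddAbove p
      have h2 : 34 / ε ^ 2 * 4 ^ n *
          (ShadowProcess.f kin (ρ p.1) * ShadowProcess.f kout (O p.2)) ≤ N :=
        (mul_le_mul_of_nonneg_left h1 (by positivity)).trans hN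
      calc 34 * (4 ^ n * (ShadowProcess.f kin (ρ p.1) * ShadowProcess.f kout (O p.2)))
          = ε ^ 2 * (34 / ε ^ 2 * 4 ^ n *
            (ShadowProcess.f kin (ρ p.1) * ShadowProcess.f kout (O p.2))) := by
            field_simp
        _ ≤ ε ^ 2 * N := by gcongr
    refine (ShadowProcess.measureReal_medianOfMeans_le kin kout hE (hρ p.1) (hO p.2) hε hK0 hNp μ Z
      hZ hindep hlaw).trans ?_
    calc Real.exp (-(K / 2)) ≤ Real.exp (-Real.log (2 * M * L / δ)) :=
          Real.exp_le_exp.2 (by linarith)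
      _ = δ / (2 * M * L) := by rw [Real.exp_neg, Real.exp_log hpos, inv_div]
  -- The bound is `δ / 2`, or an empty sum if there are no pairs.
  have hsum : ∑ p, μ.real (bad p) ≤ δ := by
    calc ∑ p, μ.real (bad p) ≤ ∑ _p : Fin L × Fin M, δ / (2 * M * L) :=
          Finset.sum_le_sum fun p _ => hbad p
      _ = (L * M) * (δ / (2 * M * L)) := by simp
      _ ≤ δ := by
          rcases eq_or_ne ((M : ℝ) * L) 0 with h0 | h0
          · rw [mul_comm (L : ℝ), h0, zero_mul]
            exact hδ.le
          · have h1 : (L * M : ℝ) * (δ / (2 * M * L)) = δ / 2 := by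
              have hM0 := left_ne_zero_of_mul h0
              have hL0 := right_ne_zero_of_mul h0
              field_simp
            rw [h1]
            linarith
  linarith
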